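/- Let $N\in\mathbb N$ and let $\mu,\nu$ be Borel probability measures on $\mathbb R^N$ with supports $\mathcal X=\operatorname{supp}\mu$ and $\mathcal Y=\operatorname{supp}\nu$. Let $\Pi(\mu,\nu)$ be the set of probability measures on $\mathbb R^N\times\mathbb R^N$ with marginals $\mu,\nu$. A plan $\gamma\in\Pi(\mu,\nu)$, with regular conditional kernel $\gamma^x(dy)$ given the first component, is called causal if for every $t\in\{1,\dots,N\}$ and every $B$ in the $\sigma$-algebra generated by $(y_1,\dots,y_t)$, the map $x\mapsto\gamma^x(B)$ is $\mu$-a.e. equal to a function measurable with respect to the $\sigma$-algebra $\mathcal F_t$ generated by $(x_1,\dots,x_t)$; $\Pi_c(\mu,\nu)$ denotes the set of causal plans. Assume that $\mu$ is successively weakly continuous: for each $t<N$ there is a version of the regular conditional kernel $(x_1,\dots,x_t)\mapsto\mu^{x_1,\dots,x_t}(dx_{t+1},\dots,dx_N)$ of $\mu$ whose restriction to the projection of $\operatorname{supp}\mu$ onto the first $t$ coordinates is continuous for the weak topology on probability measures on $\mathbb R^{N-t}$. Such a version is fixed for each $t<N$ (its values on that projection are unique). Let $\mathbb F$ be the linear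 span of the functions $$F(x,y)=\sum_{0\le t<N}h_t(y_1,\dots,y_t)\Big[g_t(x_1,\dots,x_N)-\int g_t(x_1,\dots,x_t,z_{t+1},\dots,z_N)\,\mu^{x_1,\dots,x_t}(dz_{t+1},\dots,dz_N)\Big]$$ with $h_t\in C_b(\mathbb R^t)$ and $g_t\in C_b(\mathbb R^N)$, and let $\mathbb S$ be the linear span of the functions $$S(x,y)=\sum_{0\le t<N}H_t(y_1,\dots,y_t)\big[M_{t+1}(x_1,\dots,x_{t+1})-M_t(x_1,\dots,x_t)\big]$$ with $H_t\in C_b(\mathbb R^t)$ $(0\le t<N)$ and $M_t\in C_b(\mathbb R^t)$ $(0\le t\le N)$ such that $(M_t)_{0\le t\le N}$ is a martingale under $\mu$ with respect to $(\mathcal F_t)_{0\le t\le N}$. Let $c:\mathbb R^N\times\mathbb R^N\to\mathbb R\cup\{+\infty\}$ be lower semicontinuous and bounded from below. Then $$\inf_{\gamma\in\Pi_c(\mu,\nu)}\int c\,d\gamma =\sup_{\substack{\Phi,\Psi\in C_b(\mathbb R^N),\ F\in\mathbb F\\ \Phi\oplus\Psi\le c+F}}\Big[\int\Phi\,d\mu+\int\Psi\,d\nu\Big]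 =\sup_{\substack{\Phi,\Psi\in C_b(\mathbb R^N),\ S\in\mathbb S\\ \Phi\oplus\Psi\le c+S}}\Big[\int\Phi\,d\mu+\int\Psi\,d\nu\Big]$$ in $(-\infty,+\infty]$, where $(\Phi\oplus\Psi)(x,y)=\Phi(x)+\Psi(y)$ and the inequalities are required at all points of $\mathcal X\times\mathcal Y$; moreover the infimum on the left is attained by some $\gamma\in\Pi_c(\mu,\nu)$. -/

import Mathlib

open MeasureTheory ProbabilityTheory
open scoped BoundedContinuousFunction

namespace CausalOT

noncomputable section

/-- The path space `ℝ^N`, with coordinates `x_1, …, x_N` labelled by `Fin N`. -/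
abbrev Path (N : ℕ) : Type := Fin N → ℝ

/-- The space `ℝ^t` of the first `t` coordinates of a path (for `t ≤ N`). -/
abbrev Past (N t : ℕ) : Type := {i : Fin N // (i : ℕ) < t} → ℝ

/-- The space `ℝ^(N-t)` of the coordinates number `t+1, …, N` of a path. -/
abbrev Future (N t : ℕ) : Type := {i : Fin N // ¬ (i : ℕ) < t} → ℝ

/-- `(x_1, …, x_N) ↦ (x_1, …, x_t)`. -/
def past {N : ℕ} (t : ℕ) (x : Path N) : Past N t := fun i => x i

/-- `(x_1, …, x_N) ↦ (x_{t+1}, …, x_N)`. -/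
def future {N : ℕ} (t : ℕ) (x : Path N) : Future N t := fun i => x i

/-- `((x_1, …, x_t), (x_{t+1}, …, x_N)) ↦ (x_1, …, x_N)`. -/
def glue {N : ℕ} (t : ℕ) (u : Past N t) (z : Future N t) : Path N :=
  fun i => if h : (i : ℕ) < t then u ⟨i, h⟩ else z ⟨i, h⟩

/-- The filtration generated by the coordinate process: at time `t` it is the smallest
σ-algebra for which `x ↦ (x_1, …, x_t)` is measurable (trivial for `t = 0`). -/
def coordFiltration (N : ℕ) :
    Filtration ℕ (inferInstance : MeasurableSpace (Path N)) where
  seq t := MeasurableSpace.comap (past t) inferInstance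
  mono' := by
    intro s t hst
    have h : (past s : Path N → Past N s)
        = (fun (u : Past N t) (i : {i : Fin N // (i : ℕ) < s}) =>
            u ⟨i.1, lt_of_lt_of_le i.2 hst⟩) ∘ past t := rfl
    change MeasurableSpace.comap (past s) inferInstance
      ≤ MeasurableSpace.comap (past t) inferInstance
    rw [h, ← MeasurableSpace.comap_comp]
    exact MeasurableSpace.comap_mono
      (measurable_pi_lambda _ fun _ => measurable_pi_apply _).comap_le
  le' t := (measurable_pi_lambda _ fun _ => measurable_pi_apply _ :
    Measurable (past t : Path N → Past N t)).comap_le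

/-- Transport plans: probability measures on `ℝ^N × ℝ^N` with marginals `μ` and `ν`. -/
def plans {N : ℕ} (μ ν : Measure (Path N)) : Set (ProbabilityMeasure (Path N × Path N)) :=
  {γ | (γ : Measure (Path N × Path N)).fst = μ ∧ (γ : Measure (Path N × Path N)).snd = ν}

/-- Causal transport plans: for `1 ≤ t ≤ N` and `B` in the `σ`-algebra of `y_1, …, y_t`, the map
`x ↦ γ^x(B)` is, up to a `μ`-null set, measurable with respect to `x_1, …, x_t`. -/
def causalPlans {N : ℕ} (μ ν : Measure (Path N)) :
    Set (ProbabilityMeasure (Path N × Path N)) :=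
  {γ | γ ∈ plans μ ν ∧
    ∀ t : ℕ, 1 ≤ t → t ≤ N → ∀ B : Set (Path N), MeasurableSet[coordFiltration N t] B →
      ∃ f : Path N → ENNReal, Measurable[coordFiltration N t] f ∧
        (fun x => (γ : Measure (Path N × Path N)).condKernel x B) =ᵐ[μ] f}

/-- A Markov kernel as a map into the probability measures (with their weak topology). -/
def kernelLaw {α β : Type*} [MeasurableSpace α] [MeasurableSpace β] (κ : Kernel α β)
    [IsMarkovKernel κ] (u : α) : ProbabilityMeasure β :=
  ⟨κ u, inferInstance⟩

/-- `κ` is a version of the regular conditional kernel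
`(x_1, …, x_t) ↦ μ^{x_1, …, x_t}(dx_{t+1}, …, dx_N)` which is weakly continuous on the
projection of `supp μ` to the first `t` coordinates. -/
def IsWeaklyContinuousVersion {N : ℕ} (μ : Measure (Path N)) (t : ℕ)
    (κ : Kernel (Past N t) (Future N t)) : Prop :=
  ∃ _ : IsMarkovKernel κ,
    (μ.map (fun x => (past t x, future t x))).IsCondKernel κ ∧
    ContinuousOn (kernelLaw κ) (past t '' μ.support)

/-- `μ` is successively weakly continuous. -/
def SuccessivelyWeaklyContinuous {N : ℕ} (μ : Measure (Path N)) : Prop :=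
  ∀ t < N, ∃ κ : Kernel (Past N t) (Future N t), IsWeaklyContinuousVersion μ t κ

/-- The functions
`∑_{t<N} h_t(y_1,…,y_t) [g_t(x) - ∫ g_t(x_1,…,x_t,z) μ^{x_1,…,x_t}(dz)]` with `h_t`, `g_t`
bounded and continuous. The kernels are weakly continuous versions; any two of these agree on
the projection of `supp μ`, so on `supp μ × supp ν` the function does not depend on them. -/
def causalTests {N : ℕ} (μ : Measure (Path N)) : Set (Path N × Path N → ℝ) :=
  {F | ∃ (κ : ∀ t : ℕ, Kernel (Past N t) (Future N t))
      (h : ∀ t : ℕ, Past N t →ᵇ ℝ) (g : ℕ → (Path N →ᵇ ℝ)),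
      (∀ t < N, IsWeaklyContinuousVersion μ t (κ t)) ∧
      F = fun p => ∑ t ∈ Finset.range N,
        h t (past t p.2) * (g t p.1 - ∫ z, g t (glue t (past t p.1) z) ∂(κ t (past t p.1)))}

/-- The discrete stochastic integrals
`∑_{t<N} H_t(y_1,…,y_t) [M_{t+1}(x_1,…,x_{t+1}) - M_t(x_1,…,x_t)]` with `H_t`, `M_t` bounded and
continuous and `M` a `μ`-martingale for the coordinate filtration. (That filtration is constant
from time `N` on, so the times `t > N` carry no information.) -/
def stochIntegrals {N : ℕ} (μ : Measure (Path N)) : Set (Path N × Path N → ℝ) :=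
  {S | ∃ H M : ∀ t : ℕ, Past N t →ᵇ ℝ,
      Martingale (fun t x => M t (past t x)) (coordFiltration N) μ ∧
      S = fun p => ∑ t ∈ Finset.range N,
        H t (past t p.2) * (M (t + 1) (past (t + 1) p.1) - M t (past t p.1))}

/-- The linear space generated by the causality test functions. -/
def classF {N : ℕ} (μ : Measure (Path N)) : Submodule ℝ (Path N × Path N → ℝ) :=
  Submodule.span ℝ (causalTests μ)

/-- The linear space generated by the discrete stochastic integrals. -/
def classS {N : ℕ} (μ : Measure (Path N)) : Submodule ℝ (Path N × Path N → ℝ) :=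
  Submodule.span ℝ (stochIntegrals μ)

/-- The extended-real integral `∫ c⁺ dγ - ∫ c⁻ dγ`; for `c` bounded below and `γ` finite the
second term is finite. -/
def extIntegral {Ω : Type*} [MeasurableSpace Ω] (γ : Measure Ω) (c : Ω → EReal) : EReal :=
  ((∫⁻ p, (c p).toENNReal ∂γ : ENNReal) : EReal) - ((∫⁻ p, (-c p).toENNReal ∂γ : ENNReal) : EReal)

/-- The value of the causal transport problem. -/
def causalValue {N : ℕ} (μ ν : Measure (Path N)) (c : Path N × Path N → EReal) : EReal :=
  ⨅ γ ∈ causalPlans μ ν, extIntegral (γ : Measure (Path N × Path N)) c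

/-- The dual value with test functions in `W`: the supremum of `∫ Φ dμ + ∫ Ψ dν` over
`Φ, Ψ ∈ C_b(ℝ^N)` and `F ∈ W` with `Φ ⊕ Ψ ≤ c + F` on the state space `supp μ × supp ν`. -/
def dualValue {N : ℕ} (μ ν : Measure (Path N)) (c : Path N × Path N → EReal)
    (W : Submodule ℝ (Path N × Path N → ℝ)) : EReal :=
  ⨆ (Φ : Path N →ᵇ ℝ) (Ψ : Path N →ᵇ ℝ) (F : Path N × Path N → ℝ) (_ : F ∈ W)
    (_ : ∀ x ∈ μ.support, ∀ y ∈ ν.support,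
      ((Φ x + Ψ y : ℝ) : EReal) ≤ c (x, y) + ((F (x, y) : ℝ) : EReal)),
    ((∫ x, Φ x ∂μ + ∫ y, Ψ y ∂ν : ℝ) : EReal)

end

end CausalOT

namespace CausalOT

open Filter Topology
open scoped ENNReal

/-! Weak duality is integration: a causal plan is carried by the product of the supports and
annihilates every test function, so each admissible dual triple is worth at most the plan's cost
(`dualValue_le_extIntegral`).

For strong duality with finite dual value `D`, an optimal plan is produced directly by positive
extension, without a minimax argument. Regard potentials, test functions and units of `c`, priced at
`D` each, as instruments that super-replicate a bounded continuous `f`. Since `D` is the dual value,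
zero cannot be super-replicated at negative cost (`nonneg_of_zero_mem_superCone`). Riesz extension
then gives a linear `L` on `C_b` lying below every super-replication cost. Positivity and the
marginals of `L` are read off the cone; the marginals force tightness, so `L` is integration against
a coupling (`exists_coupling_integral_eq`). The tests cost zero with either sign, which makes the
coupling causal (`mem_causalPlans_of_integral_test_eq_zero`), and every bounded continuous `f ≤ c`
costs at most `D`, which bounds the integral of `c` by `D`.

The delicate point is continuity. Conditional integrals are continuous only on the projection of the
support of `μ`, which need not be closed, whereas `L` sees only functions in `C_b`. For compactly
supported `g` the conditional expectation does have a version in `C_b`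
(`exists_boundedContinuous_ae_eq_condExp`), and such `g` suffice to detect causality. Both test
classes contain these tests, so one argument proves both dualities. -/

/-- A linear functional dominated by the costs recorded in a cone of pairs `(f, a)`. -/
lemma exists_linearMap_le_of_pointedCone {E : Type*} [AddCommGroup E] [Module ℝ E]
    (s : PointedCone ℝ (E × ℝ)) (hnonneg : ∀ a : ℝ, ((0 : E), a) ∈ s → 0 ≤ a)
    (hdom : ∀ f : E, ∃ a : ℝ, (f, a) ∈ s) :
    ∃ L : E →ₗ[ℝ] ℝ, ∀ (f : E) (a : ℝ), (f, a) ∈ s → L f ≤ a := by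
  -- The functional `(0, a) ↦ a` is extended to some `g` that is nonnegative on the cone; then `g
  -- (f, a) = a - L f` with `L f = -g (f, 0)`.
  let p : (E × ℝ) →ₗ.[ℝ] ℝ :=
    ⟨LinearMap.ker (LinearMap.fst ℝ E ℝ), (LinearMap.snd ℝ E ℝ).domRestrict _⟩
  obtain ⟨g, hg, hgs⟩ := riesz_extension s p (fun x hx => by
      obtain ⟨⟨f, a⟩, hf⟩ := x
      have hf0 : f = 0 := by simpa [p] using hf
      subst hf0
      exact hnonneg a hx) (fun y => by
      obtain ⟨a, ha⟩ := hdom y.1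
      refine ⟨⟨(0, a - y.2), by simp [p]⟩, ?_⟩
      convert ha using 1
      ext <;> simp)
  have hg1 : g (0, 1) = 1 := hg ⟨(0, 1), by simp [p]⟩
  refine ⟨-(g ∘ₗ LinearMap.inl ℝ E ℝ), fun f a hfa => ?_⟩
  have h := hgs _ hfa
  have e : ((f, a) : E × ℝ) = (f, 0) + a • ((0 : E), (1 : ℝ)) := by ext <;> simp
  rw [e, map_add, map_smul, hg1] at h
  simp only [LinearMap.neg_apply, LinearMap.comp_apply, LinearMap.inl_apply]
  simp only [smul_eq_mul, mul_one] at h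
  linarith

/-! ### From positive functionals on `C_b` to couplings -/

section Representation

variable {Z : Type*} [TopologicalSpace Z] [T2Space Z] [LocallyCompactSpace Z]
  [MeasurableSpace Z] [BorelSpace Z]

/-- A positive normalized functional on `C_b` which is tight is the integral against a
probability measure. -/
lemma exists_probabilityMeasure_integral_eq (L : (Z →ᵇ ℝ) →ₗ[ℝ] ℝ)
    (hpos : ∀ f : Z →ᵇ ℝ, (∀ z, 0 ≤ f z) → 0 ≤ L f)
    (hone : L (BoundedContinuousFunction.const Z 1) = 1)
    (htight : ∀ ε > 0, ∃ χ : Z →ᵇ ℝ, HasCompactSupport χ ∧ (∀ z, 0 ≤ χ z) ∧ (∀ z, χ z ≤ 1) ∧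
      1 - ε ≤ L χ) :
    ∃ γ : ProbabilityMeasure Z, ∀ f : Z →ᵇ ℝ, L f = ∫ z, f z ∂(γ : Measure Z) := by
  have hmono : ∀ f g : Z →ᵇ ℝ, (∀ z, f z ≤ g z) → L f ≤ L g := by
    intro f g h
    have := hpos (g - f) fun z => by simpa using h z
    rw [map_sub] at this
    linarith
  let Λ : CompactlySupportedContinuousMap Z ℝ →ₚ[ℝ] ℝ := PositiveLinearMap.mk₀
    { toFun := fun f => L f.toBoundedContinuousFunction
      map_add' := fun f g => by rw [← map_add]; rfl
      map_smul' := fun r f => by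
        rw [RingHom.id_apply, ← map_smul]; rfl }
    (fun f hf => hpos _ fun z => hf z)
  have hΛ : ∀ (f : Z →ᵇ ℝ) (hf : HasCompactSupport f),
      ∫ z, f z ∂(RealRMK.rieszMeasure Λ) = L f := by
    intro f hf
    exact RealRMK.integral_rieszMeasure Λ ⟨f.toContinuousMap, hf⟩
  set ρ := RealRMK.rieszMeasure Λ with hρ
  have hle : ρ Set.univ ≤ 1 := by
    rw [isOpen_univ.measure_eq_iSup_isCompact]
    refine iSup₂_le fun K _ => iSup_le fun hK => ?_
    obtain ⟨f, hf1, -, hfc, hf01⟩ := exists_continuous_one_zero_of_isCompact hK isClosed_empty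
      (Set.disjoint_empty K)
    refine (RealRMK.rieszMeasure_le_of_eq_one Λ (f := ⟨f, hfc⟩) (fun z => (hf01 z).1) hK
      (fun z hz => hf1 hz)).trans ?_
    rw [← ENNReal.ofReal_one]
    refine ENNReal.ofReal_le_ofReal ?_
    rw [← hone]
    exact hmono _ _ fun z => (hf01 z).2
  have : IsFiniteMeasure ρ := ⟨hle.trans_lt ENNReal.one_lt_top⟩
  have hreal : ρ.real Set.univ ≤ 1 := by
    simpa [Measure.real] using ENNReal.toReal_mono ENNReal.one_ne_top hle
  have hint : ∀ f : Z →ᵇ ℝ, Integrable f ρ := fun f => f.integrable ρ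
  have key : ∀ f : Z →ᵇ ℝ, L f = ∫ z, f z ∂ρ := by
    intro f
    -- `L` and `ρ` agree on `f * χ`. The remainder is at most `‖f‖ * (1 - χ)` in absolute value, and
    -- both functionals give this bound at most `‖f‖ * ε`; for `ρ` this uses that its mass is at
    -- most one.
    have hbound : ∀ ε > 0, |L f - ∫ z, f z ∂ρ| ≤ 2 * ‖f‖ * ε := by
      intro ε hε
      obtain ⟨χ, hχc, hχ0, hχ1, hχL⟩ := htight ε hε
      have hfχ := hΛ (f * χ) (hχc.mul_left)
      have hχρ := hΛ χ hχc
      have h0 : ∀ z, |f z| ≤ ‖f‖ := fun z => f.norm_coe_le_norm z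
      have hL1 : L (f - f * χ) ≤ ‖f‖ * (1 - L χ) := by
        have := hmono (f - f * χ) (‖f‖ • (BoundedContinuousFunction.const Z 1 - χ)) fun z => by
          have := (abs_le.1 (h0 z)).2
          have := hχ1 z
          simp only [BoundedContinuousFunction.coe_sub, BoundedContinuousFunction.coe_mul,
            BoundedContinuousFunction.coe_smul, Pi.sub_apply, Pi.mul_apply, smul_eq_mul,
            BoundedContinuousFunction.const_apply]
          nlinarith
        rwa [map_smul, map_sub L (BoundedContinuousFunction.const Z 1), hone,
          smul_eq_mul] at this
      have hL2 : -(‖f‖ * (1 - L χ)) ≤ L (f - f * χ) := by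
        have := hmono ((-‖f‖) • (BoundedContinuousFunction.const Z 1 - χ)) (f - f * χ) fun z => by
          have := (abs_le.1 (h0 z)).1
          have := hχ1 z
          simp only [BoundedContinuousFunction.coe_sub, BoundedContinuousFunction.coe_mul,
            BoundedContinuousFunction.coe_smul, Pi.sub_apply, Pi.mul_apply, smul_eq_mul,
            BoundedContinuousFunction.const_apply]
          nlinarith
        rw [map_smul, map_sub L (BoundedContinuousFunction.const Z 1), hone,
          smul_eq_mul] at this
        linarith
      have hI : |∫ z, (f z - f z * χ z) ∂ρ| ≤ ‖f‖ * (1 - L χ) := by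
        calc |∫ z, (f z - f z * χ z) ∂ρ| ≤ ∫ z, ‖f‖ * (1 - χ z) ∂ρ := by
              rw [← Real.norm_eq_abs]
              refine norm_integral_le_of_norm_le
                (((integrable_const (1 : ℝ)).sub (hint χ)).const_mul ‖f‖) (ae_of_all _ fun z => ?_)
              have h1 := hχ1 z
              rw [show f z - f z * χ z = f z * (1 - χ z) by ring, norm_mul,
                Real.norm_of_nonneg (by linarith : 0 ≤ 1 - χ z)]
              exact mul_le_mul_of_nonneg_right (h0 z) (by linarith)
          _ = ‖f‖ * (ρ.real Set.univ - L χ) := by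
              rw [integral_const_mul, integral_sub (integrable_const _) (hint χ), hχρ]
              simp
          _ ≤ ‖f‖ * (1 - L χ) := by gcongr
      have hsub : ∫ z, (f z - f z * χ z) ∂ρ = (∫ z, f z ∂ρ) - L (f * χ) := by
        rw [← hfχ]
        exact integral_sub (hint f) (hint (f * χ))
      rw [hsub] at hI
      rw [map_sub] at hL1 hL2
      have hn : 0 ≤ ‖f‖ := norm_nonneg f
      have hε' : ‖f‖ * (1 - L χ) ≤ ‖f‖ * ε := by gcongr; linarith
      rw [abs_le] at hI ⊢
      constructor <;> linarith [hI.1, hI.2]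
    have hlim : Tendsto (fun ε : ℝ => 2 * ‖f‖ * ε) (𝓝[>] 0) (𝓝 0) := by
      have : Tendsto (fun ε : ℝ => 2 * ‖f‖ * ε) (𝓝 0) (𝓝 (2 * ‖f‖ * 0)) := by
        exact (continuous_const.mul continuous_id).tendsto 0
      rw [mul_zero] at this
      exact this.mono_left nhdsWithin_le_nhds
    have := ge_of_tendsto hlim (eventually_mem_nhdsWithin.mono fun ε hε => hbound ε hε)
    exact sub_eq_zero.1 (abs_nonpos_iff.1 this)
  have huniv : ρ Set.univ = 1 := by
    have := key (BoundedContinuousFunction.const Z 1)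
    rw [hone] at this
    simp only [BoundedContinuousFunction.const_apply, integral_const, smul_eq_mul,
      mul_one] at this
    rw [Measure.real] at this
    rw [← ENNReal.ofReal_toReal (measure_ne_top ρ Set.univ), ← this, ENNReal.ofReal_one]
  exact ⟨⟨ρ, ⟨huniv⟩⟩, key⟩

end Representation

/-- Finite measures on a locally compact space have almost full mass on compactly supported
cutoffs. -/
lemma exists_cutoff_integral_ge {X : Type*} [TopologicalSpace X] [T2Space X]
    [LocallyCompactSpace X] [MeasurableSpace X] [BorelSpace X] (μ : Measure X)
    [IsProbabilityMeasure μ] [μ.Regular] {ε : ℝ} (hε : 0 < ε) :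
    ∃ χ : X →ᵇ ℝ, HasCompactSupport χ ∧ (∀ x, 0 ≤ χ x) ∧ (∀ x, χ x ≤ 1) ∧
      1 - ε ≤ ∫ x, χ x ∂μ := by
  obtain ⟨K, -, hK, hKμ⟩ := isOpen_univ.exists_lt_isCompact (μ := μ) (r := ENNReal.ofReal (1 - ε))
    (by rw [measure_univ, ← ENNReal.ofReal_one]
        exact (ENNReal.ofReal_lt_ofReal_iff zero_lt_one).2 (by linarith))
  obtain ⟨f, hf1, -, hfc, hf01⟩ := exists_continuous_one_zero_of_isCompact hK isClosed_empty
    (Set.disjoint_empty K)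
  let χ : X →ᵇ ℝ := BoundedContinuousFunction.ofNormedAddCommGroup f f.continuous 1 fun x => by
    rw [Real.norm_of_nonneg (hf01 x).1]; exact (hf01 x).2
  refine ⟨χ, hfc, fun x => (hf01 x).1, fun x => (hf01 x).2, ?_⟩
  have h1 : 1 - ε ≤ μ.real K := by
    have := (ENNReal.ofReal_le_iff_le_toReal (measure_ne_top μ K)).1 hKμ.le
    exact this
  have h2 : μ.real K = ∫ x, K.indicator (fun _ => (1 : ℝ)) x ∂μ := by
    rw [integral_indicator hK.isClosed.measurableSet]; simp
  rw [h2] at h1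
  refine h1.trans (integral_mono ((integrable_const 1).indicator hK.isClosed.measurableSet)
    (χ.integrable μ) fun x => ?_)
  by_cases hx : x ∈ K
  · simp only [Set.indicator_of_mem hx]; exact (hf1 hx).ge
  · simp only [Set.indicator_of_notMem hx]; exact (hf01 x).1

/-- The function `(x, y) ↦ Φ x + Ψ y`. -/
noncomputable def directSum {X Y : Type*} [TopologicalSpace X] [TopologicalSpace Y]
    (Φ : X →ᵇ ℝ) (Ψ : Y →ᵇ ℝ) : X × Y →ᵇ ℝ :=
  Φ.compContinuous ⟨Prod.fst, continuous_fst⟩ + Ψ.compContinuous ⟨Prod.snd, continuous_snd⟩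

@[simp]
lemma directSum_apply {X Y : Type*} [TopologicalSpace X] [TopologicalSpace Y]
    (Φ : X →ᵇ ℝ) (Ψ : Y →ᵇ ℝ) (p : X × Y) : directSum Φ Ψ p = Φ p.1 + Ψ p.2 := rfl

/-- A positive functional on `C_b(X × Y)` with prescribed marginals is given by a coupling. -/
lemma exists_coupling_integral_eq {X Y : Type*}
    [TopologicalSpace X] [T2Space X] [LocallyCompactSpace X] [SecondCountableTopology X]
    [HasOuterApproxClosed X] [MeasurableSpace X] [BorelSpace X]
    [TopologicalSpace Y] [T2Space Y] [LocallyCompactSpace Y] [SecondCountableTopology Y]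
    [HasOuterApproxClosed Y] [MeasurableSpace Y] [BorelSpace Y]
    (μ : Measure X) (ν : Measure Y) [IsProbabilityMeasure μ] [IsProbabilityMeasure ν]
    [μ.Regular] [ν.Regular]
    (L : (X × Y →ᵇ ℝ) →ₗ[ℝ] ℝ) (hpos : ∀ f : X × Y →ᵇ ℝ, (∀ z, 0 ≤ f z) → 0 ≤ L f)
    (hmarg : ∀ (Φ : X →ᵇ ℝ) (Ψ : Y →ᵇ ℝ), L (directSum Φ Ψ) = ∫ x, Φ x ∂μ + ∫ y, Ψ y ∂ν) :
    ∃ γ : ProbabilityMeasure (X × Y),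
      (γ : Measure (X × Y)).fst = μ ∧ (γ : Measure (X × Y)).snd = ν ∧
      ∀ f : X × Y →ᵇ ℝ, L f = ∫ z, f z ∂(γ : Measure (X × Y)) := by
  have hone : L (BoundedContinuousFunction.const (X × Y) 1) = 1 := by
    have := hmarg (BoundedContinuousFunction.const X 1) 0
    simp only [BoundedContinuousFunction.const_apply, integral_const, probReal_univ, smul_eq_mul,
      mul_one, BoundedContinuousFunction.coe_zero, Pi.zero_apply, mul_zero, add_zero] at this
    convert this using 2
    ext p
    simp
  obtain ⟨γ, hγ⟩ := exists_probabilityMeasure_integral_eq L hpos hone (by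
    intro ε hε
    obtain ⟨χ₁, hc₁, h0₁, h1₁, hi₁⟩ := exists_cutoff_integral_ge μ (half_pos hε)
    obtain ⟨χ₂, hc₂, h0₂, h1₂, hi₂⟩ := exists_cutoff_integral_ge ν (half_pos hε)
    let χ : X × Y →ᵇ ℝ := χ₁.compContinuous ⟨Prod.fst, continuous_fst⟩ *
      χ₂.compContinuous ⟨Prod.snd, continuous_snd⟩
    have hχ : ∀ p, χ p = χ₁ p.1 * χ₂ p.2 := fun p => rfl
    refine ⟨χ, ?_, fun z => ?_, fun z => ?_, ?_⟩
    · refine HasCompactSupport.intro (hc₁.isCompact.prod hc₂.isCompact) fun p hp => ?_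
      rw [hχ]
      rw [Set.mem_prod, not_and_or] at hp
      rcases hp with hp | hp
      · rw [image_eq_zero_of_notMem_tsupport hp, zero_mul]
      · rw [image_eq_zero_of_notMem_tsupport hp, mul_zero]
    · rw [hχ]; exact mul_nonneg (h0₁ _) (h0₂ _)
    · rw [hχ]; exact mul_le_one₀ (h1₁ _) (h0₂ _) (h1₂ _)
    -- Since `(1 - χ₁) * (1 - χ₂) ≥ 0`, the product is at least `χ₁ + χ₂ - 1`, on which the
    -- marginals determine `L`.
    · have := hpos (χ - (directSum χ₁ χ₂ - BoundedContinuousFunction.const _ 1)) fun z => by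
        simp only [BoundedContinuousFunction.coe_sub, Pi.sub_apply, hχ, directSum_apply,
          BoundedContinuousFunction.const_apply]
        nlinarith [h1₁ z.1, h1₂ z.2]
      rw [map_sub, map_sub, hone, hmarg] at this
      linarith)
  refine ⟨γ, ?_, ?_, hγ⟩
  · refine ext_of_forall_integral_eq_of_IsFiniteMeasure fun Φ => ?_
    have := hmarg Φ 0
    rw [hγ] at this
    rw [Measure.fst, integral_map measurable_fst.aemeasurable
      Φ.continuous.aestronglyMeasurable]
    simpa using this
  · refine ext_of_forall_integral_eq_of_IsFiniteMeasure fun Ψ => ?_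
    have := hmarg 0 Ψ
    rw [hγ] at this
    rw [Measure.snd, integral_map measurable_snd.aemeasurable
      Ψ.continuous.aestronglyMeasurable]
    simpa using this

/-! ### Lower semicontinuous costs and extended integrals -/

/-- A lower semicontinuous function which is bounded below is the limit of an increasing sequence
of bounded continuous functions. -/
lemma exists_seq_boundedContinuous_tendsto {Z : Type*} [PseudoMetricSpace Z] {c : Z → EReal}
    (hc : LowerSemicontinuous c) {b : ℝ} (hb : ∀ z, (b : EReal) ≤ c z) :
    ∃ f : ℕ → (Z →ᵇ ℝ), (∀ z, Monotone fun n => f n z) ∧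
      (∀ n z, ((f n z : ℝ) : EReal) ≤ c z) ∧
      ∀ z, Tendsto (fun n => ((f n z : ℝ) : EReal)) atTop (𝓝 (c z)) := by
  let a : ℕ → Z → ℝ := fun n w => (min (c w) ((max b n : ℝ) : EReal)).toReal
  have ha : ∀ n w, ((a n w : ℝ) : EReal) = min (c w) ((max b n : ℝ) : EReal) := fun n w =>
    EReal.coe_toReal (ne_top_of_le_ne_top (EReal.coe_ne_top _) (min_le_right _ _))
      (ne_bot_of_le_ne_bot (EReal.coe_ne_bot b)
        (le_min (hb w) (EReal.coe_le_coe_iff.2 (le_max_left _ _))))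
  have hab : ∀ n w, b ≤ a n w := fun n w => by
    rw [← EReal.coe_le_coe_iff, ha]
    exact le_min (hb w) (EReal.coe_le_coe_iff.2 (le_max_left _ _))
  have han : ∀ n w, a n w ≤ max b n := fun n w => by
    rw [← EReal.coe_le_coe_iff, ha]; exact min_le_right _ _
  have hac : ∀ n w, ((a n w : ℝ) : EReal) ≤ c w := fun n w => by
    rw [ha]; exact min_le_left _ _
  have hamono : ∀ w, Monotone fun n => a n w := fun w m n hmn => by
    simp only
    rw [← EReal.coe_le_coe_iff, ha, ha]
    refine min_le_min le_rfl (EReal.coe_le_coe_iff.2 (max_le_max le_rfl ?_))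
    exact_mod_cast hmn
  have hterm : ∀ (n : ℕ) (z w : Z), b ≤ a n w + n * dist z w := fun n z w => by
    have := mul_nonneg (Nat.cast_nonneg (α := ℝ) n) (dist_nonneg (x := z) (y := w))
    linarith [hab n w]
  have hbdd : ∀ (n : ℕ) (z : Z), BddBelow (Set.range fun w => a n w + n * dist z w) :=
    fun n z => ⟨b, by rintro _ ⟨w, rfl⟩; exact hterm n z w⟩
  -- Lipschitz regularization of the truncation `a n`: raising `n` raises both the cap and the
  -- slope, hence monotonicity.
  let q : ℕ → Z → ℝ := fun n z => ⨅ w, (a n w + n * dist z w)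
  have hqa : ∀ n z, q n z ≤ a n z := fun n z => by
    simpa using ciInf_le (hbdd n z) z
  have hqb : ∀ n z, b ≤ q n z := fun n z => by
    have : Nonempty Z := ⟨z⟩
    exact le_ciInf (hterm n z)
  have hlip : ∀ n : ℕ, LipschitzWith (n : NNReal) (q n) := fun n => by
    refine LipschitzWith.of_le_add_mul _ fun x y => ?_
    have : Nonempty Z := ⟨x⟩
    rw [← sub_le_iff_le_add]
    refine le_ciInf fun w => ?_
    rw [sub_le_iff_le_add]
    refine (ciInf_le (hbdd n x) w).trans ?_
    have := mul_le_mul_of_nonneg_left (dist_triangle x y w) (Nat.cast_nonneg (α := ℝ) n)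
    simp only [NNReal.coe_natCast]
    linarith
  refine ⟨fun n => BoundedContinuousFunction.ofNormedAddCommGroup (q n) (hlip n).continuous
    (max |b| |max b n|) fun z => abs_le_max_abs_abs (hqb n z) ((hqa n z).trans (han n z)),
    fun z m n hmn => ?_, fun n z => ?_, fun z => ?_⟩
  · have : Nonempty Z := ⟨z⟩
    refine le_ciInf fun w => (ciInf_le (hbdd m z) w).trans ?_
    have h1 : a m w ≤ a n w := hamono w hmn
    have h2 : (m : ℝ) * dist z w ≤ n * dist z w :=
      mul_le_mul_of_nonneg_right (by exact_mod_cast hmn) dist_nonneg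
    linarith
  · exact (EReal.coe_le_coe_iff.2 (hqa n z)).trans (hac n z)
  · refine tendsto_order.2 ⟨fun r hr => ?_, fun r hr => Eventually.of_forall fun n =>
      ((EReal.coe_le_coe_iff.2 (hqa n z)).trans (hac n z)).trans_lt hr⟩
    obtain ⟨s, hrs, hs⟩ := EReal.lt_iff_exists_real_btwn.1 hr
    obtain ⟨δ, hδ, hball⟩ := Metric.eventually_nhds_iff.1 (hc z s hs)
    obtain ⟨n₁, hn₁⟩ := exists_nat_ge s
    obtain ⟨n₂, hn₂⟩ := exists_nat_ge ((s - b) / δ)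
    filter_upwards [eventually_ge_atTop n₁, eventually_ge_atTop n₂] with n h₁ h₂
    refine hrs.trans_le (EReal.coe_le_coe_iff.2 ?_)
    have : Nonempty Z := ⟨z⟩
    refine le_ciInf fun w => ?_
    have h₁' : s ≤ n := hn₁.trans (by exact_mod_cast h₁)
    have h₂' : (s - b) / δ ≤ n := hn₂.trans (by exact_mod_cast h₂)
    have hd := dist_nonneg (x := z) (y := w)
    have hnn := Nat.cast_nonneg (α := ℝ) n
    -- Near `z`, semicontinuity keeps `a n w` above `s`; away from `z`, the penalty `n * δ` makes up
    -- for `s - b`.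
    rcases lt_or_ge (dist z w) δ with hlt | hge
    · have : s ≤ a n w := by
        rw [← EReal.coe_le_coe_iff, ha]
        refine le_min (hball (by rwa [dist_comm])).le (EReal.coe_le_coe_iff.2 ?_)
        exact h₁'.trans (le_max_right _ _)
      linarith [mul_nonneg hnn hd]
    · rw [div_le_iff₀ hδ] at h₂'
      have := mul_le_mul_of_nonneg_left hge hnn
      linarith [hab n w]

section ExtIntegral

variable {Z : Type*} [MeasurableSpace Z]

lemma extIntegral_coe {γ : Measure Z} {f : Z → ℝ} (hf : Integrable f γ) :
    extIntegral γ (fun z => (f z : EReal)) = ((∫ z, f z ∂γ : ℝ) : EReal) := by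
  rw [integral_eq_lintegral_pos_part_sub_lintegral_neg_part hf, EReal.coe_sub,
    EReal.coe_ennreal_toReal hf.lintegral_lt_top.ne,
    EReal.coe_ennreal_toReal (x := ∫⁻ z, ENNReal.ofReal (-f z) ∂γ) hf.neg.lintegral_lt_top.ne]
  rfl

lemma extIntegral_mono_ae {γ : Measure Z} {c d : Z → EReal} (h : ∀ᵐ z ∂γ, c z ≤ d z) :
    extIntegral γ c ≤ extIntegral γ d := by
  refine EReal.sub_le_sub ?_ ?_
  · exact EReal.coe_ennreal_le_coe_ennreal_iff.2
      (lintegral_mono_ae (h.mono fun z hz => EReal.toENNReal_le_toENNReal hz))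
  · exact EReal.coe_ennreal_le_coe_ennreal_iff.2
      (lintegral_mono_ae (h.mono fun z hz =>
        EReal.toENNReal_le_toENNReal (EReal.neg_le_neg_iff.2 hz)))

end ExtIntegral

/-- The integral of a lower semicontinuous function is determined by its bounded continuous
minorants. -/
lemma extIntegral_le_of_forall_boundedContinuous {Z : Type*} [PseudoMetricSpace Z]
    [MeasurableSpace Z] [BorelSpace Z] {γ : Measure Z} [IsFiniteMeasure γ] {c : Z → EReal}
    (hc : LowerSemicontinuous c) {b : ℝ} (hb : ∀ z, (b : EReal) ≤ c z) {D : ℝ}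
    (hD : ∀ f : Z →ᵇ ℝ, (∀ z, ((f z : ℝ) : EReal) ≤ c z) → ∫ z, f z ∂γ ≤ D) :
    extIntegral γ c ≤ D := by
  obtain ⟨f, hmono, hle, hlim⟩ := exists_seq_boundedContinuous_tendsto hc hb
  have hmeas : ∀ n, Measurable fun z => ((f n z : ℝ) : EReal) := fun n =>
    (f n).continuous.measurable.coe_real_ereal
  have hpos : Tendsto (fun n => ∫⁻ z, ((f n z : ℝ) : EReal).toENNReal ∂γ) atTop
      (𝓝 (∫⁻ z, (c z).toENNReal ∂γ)) := by
    refine lintegral_tendsto_of_tendsto_of_monotone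
      (fun n => (hmeas n).ereal_toENNReal.aemeasurable) (ae_of_all _ fun z m n hmn => ?_)
      (ae_of_all _ fun z => (EReal.continuous_toENNReal.tendsto _).comp (hlim z))
    exact EReal.toENNReal_le_toENNReal (EReal.coe_le_coe_iff.2 (hmono z hmn))
  have hfin : ∫⁻ z, (-((f 0 z : ℝ) : EReal)).toENNReal ∂γ ≠ ∞ :=
    ((f 0).integrable γ).neg.lintegral_lt_top.ne
  have hneg : Tendsto (fun n => ∫⁻ z, (-((f n z : ℝ) : EReal)).toENNReal ∂γ) atTop
      (𝓝 (∫⁻ z, (-c z).toENNReal ∂γ)) := by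
    refine lintegral_tendsto_of_tendsto_of_antitone
      (fun n => (hmeas n).neg.ereal_toENNReal.aemeasurable) (ae_of_all _ fun z m n hmn => ?_) hfin
      (ae_of_all _ fun z => ((EReal.continuous_toENNReal.comp continuous_neg).tendsto _).comp
        (hlim z))
    exact EReal.toENNReal_le_toENNReal
      (EReal.neg_le_neg_iff.2 (EReal.coe_le_coe_iff.2 (hmono z hmn)))
  have hfin' : ∫⁻ z, (-c z).toENNReal ∂γ ≠ ∞ := by
    refine ne_top_of_le_ne_top hfin (lintegral_mono fun z => ?_)
    exact EReal.toENNReal_le_toENNReal (EReal.neg_le_neg_iff.2 (hle 0 z))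
  have key : Tendsto (fun n => extIntegral γ fun z => ((f n z : ℝ) : EReal)) atTop
      (𝓝 (extIntegral γ c)) := by
    have h1 := (continuous_coe_ennreal_ereal.tendsto _).comp hpos
    have h2 := (continuous_neg.tendsto _).comp ((continuous_coe_ennreal_ereal.tendsto _).comp hneg)
    -- Addition is continuous here because the negative part has finite integral, which excludes `∞
    -- - ∞`.
    have h3 := EReal.continuousAt_add
      (p := (((∫⁻ z, (c z).toENNReal ∂γ : ℝ≥0∞) : EReal),
        -((∫⁻ z, (-c z).toENNReal ∂γ : ℝ≥0∞) : EReal)))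
      (Or.inr (by simpa using hfin')) (Or.inl (EReal.coe_ennreal_ne_bot _))
    exact h3.tendsto.comp (h1.prodMk_nhds h2)
  refine le_of_tendsto' key fun n => ?_
  rw [extIntegral_coe ((f n).integrable γ)]
  exact EReal.coe_le_coe_iff.2 (hD _ (hle n))

/-! ### Causality as orthogonality to test functions -/

section Causality

section CondExp

variable {Ω : Type*} {m m₀ : MeasurableSpace Ω} {μ : Measure[m₀] Ω} [IsProbabilityMeasure μ]

/-- Conditional expectation is symmetric on bounded functions. -/
lemma integral_condExp_mul_comm (hm : m ≤ m₀) {f g : Ω → ℝ} {C : ℝ}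
    (hf : Integrable f μ) (hg : Integrable g μ) (hC : ∀ x, |f x| ≤ C) {C' : ℝ}
    (hC' : ∀ x, |g x| ≤ C') :
    ∫ x, (μ[f | m]) x * g x ∂μ = ∫ x, f x * (μ[g | m]) x ∂μ := by
  -- Both sides equal the integral of the product of the two conditional expectations.
  have aux : ∀ {f g : Ω → ℝ} {C : ℝ}, Integrable f μ → Integrable g μ → (∀ x, |f x| ≤ C) →
      ∫ x, f x * (μ[g | m]) x ∂μ = ∫ x, (μ[f | m]) x * (μ[g | m]) x ∂μ := by
    intro f g C hf hg hC
    have hint : Integrable (f * μ[g | m]) μ :=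
      Integrable.bdd_mul (c := C) integrable_condExp hf.aestronglyMeasurable (ae_of_all _ hC)
    have h := condExp_mul_of_stronglyMeasurable_right (m := m) stronglyMeasurable_condExp hint hf
    calc ∫ x, f x * (μ[g | m]) x ∂μ = ∫ x, (μ[f * μ[g | m] | m]) x ∂μ :=
          (integral_condExp hm).symm
      _ = _ := integral_congr_ae h
  rw [aux hf hg hC]
  simp_rw [mul_comm _ (g _), aux hg hf hC', mul_comm]

end CondExp

variable {N : ℕ}

lemma measurable_past (t : ℕ) : Measurable (past t : Path N → Past N t) :=
  measurable_pi_lambda _ fun _ => measurable_pi_apply _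

lemma continuous_past (t : ℕ) : Continuous (past t : Path N → Past N t) :=
  continuous_pi fun _ => continuous_apply _

lemma measurable_coordFiltration_comp_past {β : Type*} [MeasurableSpace β] (t : ℕ)
    {f : Past N t → β} (hf : Measurable f) :
    Measurable[coordFiltration N t] fun x => f (past t x) :=
  hf.comp (comap_measurable _)

/-- From time `N` on the coordinate filtration is the full Borel σ-algebra. -/
lemma coordFiltration_eq_of_le {t : ℕ} (ht : N ≤ t) :
    coordFiltration N t = (inferInstance : MeasurableSpace (Path N)) := by
  refine le_antisymm ((coordFiltration N).le t) fun s hs => ?_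
  refine ⟨(fun (u : Past N t) (i : Fin N) => u ⟨i, i.2.trans_le ht⟩) ⁻¹' s,
    (measurable_pi_lambda _ fun _ => measurable_pi_apply _) hs, rfl⟩

section Disintegration

variable (γ : Measure (Path N × Path N)) [IsFiniteMeasure γ]

lemma abs_integral_condKernel_le {H : Path N → ℝ} {C : ℝ} (hC : ∀ y, |H y| ≤ C) (x : Path N) :
    |∫ y, H y ∂γ.condKernel x| ≤ C := by
  simpa using norm_integral_le_of_norm_le_const (f := H) (μ := γ.condKernel x) (ae_of_all _ hC)

lemma measurable_integral_condKernel {H : Path N → ℝ} (hH : Measurable H) :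
    Measurable fun x => ∫ y, H y ∂γ.condKernel x :=
  (StronglyMeasurable.integral_kernel_prod_right
    (f := fun (_ : Path N) y => H y) (κ := γ.condKernel)
    (hH.comp measurable_snd).stronglyMeasurable).measurable

lemma integral_mul_eq_integral_condKernel {G H : Path N → ℝ} (hG : Integrable G γ.fst)
    (hH : Measurable H) {C : ℝ} (hC : ∀ y, |H y| ≤ C) :
    Integrable (fun p : Path N × Path N => H p.2 * G p.1) γ ∧
    ∫ p, H p.2 * G p.1 ∂γ = ∫ x, (∫ y, H y ∂γ.condKernel x) * G x ∂γ.fst := by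
  have hint : Integrable (fun p : Path N × Path N => H p.2 * G p.1) γ :=
    Integrable.bdd_mul (c := C) (hG.comp_measurable measurable_fst)
      (hH.comp measurable_snd).aestronglyMeasurable (ae_of_all _ fun p => hC p.2)
  refine ⟨hint, ?_⟩
  rw [← Measure.integral_condKernel hint]
  simp_rw [integral_mul_const]

end Disintegration

section Causal

variable {μ ν : Measure (Path N)}

/-- Under a causal plan the conditional law of the past of `y` given `x` integrates measurable
functions to functions of the past of `x`. -/
lemma exists_measurable_lintegral_condKernel {γ : ProbabilityMeasure (Path N × Path N)}
    (hγ : γ ∈ causalPlans μ ν) {t : ℕ} (h1 : 1 ≤ t) (ht : t ≤ N) {h : Past N t → ℝ≥0∞}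
    (hh : Measurable h) :
    ∃ f : Path N → ℝ≥0∞, Measurable[coordFiltration N t] f ∧
      (fun x => ∫⁻ y, h (past t y) ∂(γ : Measure (Path N × Path N)).condKernel x) =ᵐ[μ] f := by
  refine Measurable.ennreal_induction (motive := fun h => ∃ f : Path N → ℝ≥0∞,
    Measurable[coordFiltration N t] f ∧
      (fun x => ∫⁻ y, h (past t y) ∂(γ : Measure (Path N × Path N)).condKernel x) =ᵐ[μ] f)
    (fun c s hs => ?_) (fun f g _ hf hg ihf ihg => ?_) (fun f hf hmono ih => ?_) hh
  · obtain ⟨f, hf, hfe⟩ := hγ.2 t h1 ht (past t ⁻¹' s) ⟨s, hs, rfl⟩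
    refine ⟨fun x => c * f x, hf.const_mul c, ?_⟩
    filter_upwards [hfe] with x hx
    rw [← hx, ← lintegral_indicator_const (measurable_past t hs)]
    rfl
  · obtain ⟨f', hf', hfe⟩ := ihf
    obtain ⟨g', hg', hge⟩ := ihg
    refine ⟨fun x => f' x + g' x, hf'.add hg', ?_⟩
    filter_upwards [hfe, hge] with x hx hx'
    rw [← hx, ← hx']
    exact lintegral_add_left (hf.comp (measurable_past t)) _
  · choose f' hf' hfe using ih
    refine ⟨fun x => ⨆ n, f' n x, Measurable.iSup hf', ?_⟩
    filter_upwards [ae_all_iff.2 hfe] with x hx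
    exact (lintegral_iSup (fun n => (hf n).comp (measurable_past t))
      fun m n hmn y => hmono hmn (past t y)).trans (iSup_congr hx)

/-- Adding `‖h‖` makes `h` nonnegative and reduces to the Lebesgue integral. Time zero is separate
because the causality condition starts at `t = 1`; there `h` is constant, `ℝ^0` being a point. -/
lemma aestronglyMeasurable_integral_condKernel {γ : ProbabilityMeasure (Path N × Path N)}
    (hγ : γ ∈ causalPlans μ ν) {t : ℕ} (ht : t ≤ N) (h : Past N t →ᵇ ℝ) :
    AEStronglyMeasurable[coordFiltration N t]
      (fun x => ∫ y, h (past t y) ∂(γ : Measure (Path N × Path N)).condKernel x) μ := by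
  rcases Nat.eq_zero_or_pos t with rfl | h1
  · have hconst : ∀ y : Path N, h (past 0 y) = h 0 := fun y => by
      congr 1
      ext i
      exact absurd i.2 (Nat.not_lt_zero _)
    simp only [hconst, integral_const, probReal_univ, smul_eq_mul, one_mul]
    exact stronglyMeasurable_const.aestronglyMeasurable
  · have hb : ∀ u, |h u| ≤ ‖h‖ := fun u => h.norm_coe_le_norm u
    obtain ⟨f, hf, hfe⟩ := exists_measurable_lintegral_condKernel hγ h1 ht
      (h := fun u => ENNReal.ofReal (h u + ‖h‖))
      (ENNReal.measurable_ofReal.comp (h.continuous.measurable.add_const _))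
    refine ⟨fun x => (f x).toReal - ‖h‖, (hf.ennreal_toReal.sub_const _).stronglyMeasurable, ?_⟩
    filter_upwards [hfe] with x hx
    have hint : Integrable (fun y => h (past t y))
        ((γ : Measure (Path N × Path N)).condKernel x) :=
      Integrable.of_bound (h.continuous.measurable.comp (measurable_past t)).aestronglyMeasurable
        ‖h‖ (ae_of_all _ fun y => hb _)
    have hadd : ∫ y, (h (past t y) + ‖h‖) ∂(γ : Measure (Path N × Path N)).condKernel x
        = (f x).toReal := by
      rw [← hx]
      refine integral_eq_lintegral_of_nonneg_ae (ae_of_all _ fun y => ?_)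
        (hint.add (integrable_const _)).aestronglyMeasurable
      exact neg_le_iff_add_nonneg.1 (abs_le.1 (hb (past t y))).1
    rw [← hadd, integral_add hint (integrable_const _)]
    simp

variable [IsProbabilityMeasure μ]

/-- Causal plans annihilate the elementary causality tests. -/
lemma integral_test_eq_zero {γ : ProbabilityMeasure (Path N × Path N)}
    (hγ : γ ∈ causalPlans μ ν) {t : ℕ} (ht : t ≤ N) (h : Past N t →ᵇ ℝ) {g G : Path N → ℝ}
    (hg : Integrable g μ) (hG : G =ᵐ[μ] μ[g | coordFiltration N t]) :
    Integrable (fun p : Path N × Path N => h (past t p.2) * (g p.1 - G p.1))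
      (γ : Measure (Path N × Path N)) ∧
    ∫ p, h (past t p.2) * (g p.1 - G p.1) ∂(γ : Measure (Path N × Path N)) = 0 := by
  have hfst := hγ.1.1
  have hGi : Integrable G μ := integrable_condExp.congr hG.symm
  have hb : ∀ y : Path N, |h (past t y)| ≤ ‖h‖ := fun y => h.norm_coe_le_norm _
  have hk := aestronglyMeasurable_integral_condKernel hγ ht h
  have hhm : Measurable fun y : Path N => h (past t y) :=
    h.continuous.measurable.comp (measurable_past t)
  obtain ⟨hint, heq⟩ := integral_mul_eq_integral_condKernel (γ : Measure (Path N × Path N))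
    (G := fun x => g x - G x) (by rw [hfst]; exact hg.sub hGi) hhm hb
  refine ⟨hint, ?_⟩
  rw [heq, hfst]
  set k : Path N → ℝ := fun x =>
    ∫ y, h (past t y) ∂(γ : Measure (Path N × Path N)).condKernel x with hkdef
  have hkb : ∀ x, |k x| ≤ ‖h‖ := abs_integral_condKernel_le _ hb
  have hkm : Measurable k := measurable_integral_condKernel _ hhm
  have hkg : Integrable (k * g) μ :=
    Integrable.bdd_mul (c := ‖h‖) hg hkm.aestronglyMeasurable (ae_of_all _ hkb)
  have hkG : Integrable (fun x => k x * G x) μ :=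
    Integrable.bdd_mul (c := ‖h‖) hGi hkm.aestronglyMeasurable (ae_of_all _ hkb)
  -- Causality enters here: `k` is a function of the past of `x` up to a null set, so it pulls out
  -- of the conditional expectation.
  have hpull := condExp_mul_of_aestronglyMeasurable_left hk hkg hg
  have hKG : ∫ x, k x * G x ∂μ = ∫ x, k x * g x ∂μ := by
    rw [show ∫ x, k x * g x ∂μ = ∫ x, (μ[k * g | coordFiltration N t]) x ∂μ from
      (integral_condExp ((coordFiltration N).le t)).symm]
    refine integral_congr_ae ?_
    filter_upwards [hpull, hG] with x hx hx'
    rw [hx, hx']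
    rfl
  have hsub : ∫ x, (k x * g x - k x * G x) ∂μ = 0 := by
    rw [integral_sub (f := fun x => k x * g x) hkg hkG, hKG, sub_self]
  rw [← hsub]
  exact integral_congr_ae (ae_of_all _ fun x => mul_sub _ _ _)

/-- A plan annihilating the elementary causality tests with compactly supported `g` is causal. -/
lemma mem_causalPlans_of_integral_test_eq_zero {γ : ProbabilityMeasure (Path N × Path N)}
    (hγ : γ ∈ plans μ ν)
    (htest : ∀ t < N, ∀ (h : Past N t →ᵇ ℝ) (g : Path N →ᵇ ℝ), HasCompactSupport g →
      ∃ G : Path N → ℝ, G =ᵐ[μ] μ[g | coordFiltration N t] ∧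
        ∫ p, h (past t p.2) * (g p.1 - G p.1) ∂(γ : Measure (Path N × Path N)) = 0) :
    γ ∈ causalPlans μ ν := by
  refine ⟨hγ, fun t _ htN B hB => ?_⟩
  have hm := (coordFiltration N).le t
  rcases htN.lt_or_eq with ht | rfl
  swap
  -- At time `N` the filtration is the full σ-algebra, so the condition is only measurability of the
  -- kernel.
  · refine ⟨_, ?_, ae_eq_refl _⟩
    rw [coordFiltration_eq_of_le le_rfl] at hB ⊢
    exact Kernel.measurable_coe _ hB
  have hfst := hγ.1
  -- Tested against smooth compactly supported `g`, symmetry of conditional expectation moves it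
  -- from `k` to `g`; the hypothesis then says that `k` has the same integral against `G` and `g`.
  have hkey : ∀ h : Past N t →ᵇ ℝ,
      (fun x => ∫ y, h (past t y) ∂(γ : Measure (Path N × Path N)).condKernel x) =ᵐ[μ]
        μ[fun x => ∫ y, h (past t y) ∂(γ : Measure (Path N × Path N)).condKernel x |
          coordFiltration N t] := by
    intro h
    have hb : ∀ y : Path N, |h (past t y)| ≤ ‖h‖ := fun y => h.norm_coe_le_norm _
    have hhm : Measurable fun y : Path N => h (past t y) :=
      h.continuous.measurable.comp (measurable_past t)
    set k : Path N → ℝ := fun x =>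
      ∫ y, h (past t y) ∂(γ : Measure (Path N × Path N)).condKernel x with hkdef
    have hkb : ∀ x, |k x| ≤ ‖h‖ := abs_integral_condKernel_le _ hb
    have hkm : Measurable k := measurable_integral_condKernel _ hhm
    have hki : Integrable k μ := Integrable.of_bound hkm.aestronglyMeasurable ‖h‖ (ae_of_all _ hkb)
    refine ae_eq_of_integral_contDiff_smul_eq hki.locallyIntegrable
      integrable_condExp.locallyIntegrable fun g hg hgc => ?_
    obtain ⟨C, hC⟩ := hgc.exists_bound_of_continuous hg.continuous
    let g' : Path N →ᵇ ℝ := BoundedContinuousFunction.ofNormedAddCommGroup g hg.continuous C hC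
    obtain ⟨G, hG, hG0⟩ := htest t ht h g' hgc
    have hgi : Integrable g μ := g'.integrable μ
    have hGi : Integrable G μ := integrable_condExp.congr hG.symm
    rw [(integral_mul_eq_integral_condKernel (γ : Measure (Path N × Path N))
      (G := fun x => g' x - G x) (by rw [hfst]; exact hgi.sub hGi) hhm hb).2, hfst] at hG0
    have hkg : Integrable (fun x => k x * g x) μ :=
      Integrable.bdd_mul (c := ‖h‖) hgi hkm.aestronglyMeasurable (ae_of_all _ hkb)
    have hkG : Integrable (fun x => k x * G x) μ :=
      Integrable.bdd_mul (c := ‖h‖) hGi hkm.aestronglyMeasurable (ae_of_all _ hkb)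
    have hsub : ∫ x, k x * g x ∂μ = ∫ x, k x * G x ∂μ := by
      rw [← sub_eq_zero, ← integral_sub hkg hkG, ← hG0]
      refine integral_congr_ae (ae_of_all _ fun x => ?_)
      exact (mul_sub _ _ _).symm
    simp only [smul_eq_mul]
    rw [← integral_condExp_mul_comm hm hgi hki hC hkb]
    simp_rw [mul_comm (g _)]
    rw [hsub]
    refine integral_congr_ae ?_
    filter_upwards [hG] with x hx
    rw [hx, mul_comm]
    rfl
  obtain ⟨B', hB', rfl⟩ := hB
  have hgen : (inferInstance : MeasurableSpace (Past N t))
      = MeasurableSpace.generateFrom {s | IsClosed s} := by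
    rw [← borel_eq_generateFrom_isClosed]
    exact BorelSpace.measurable_eq
  -- Closed sets are reached by continuous approximation from above, all Borel sets by a π-λ
  -- argument.
  induction B', hB' using MeasurableSpace.induction_on_inter hgen isPiSystem_isClosed with
  | empty =>
    exact ⟨fun _ => 0, measurable_const, by simp⟩
  | basic F hF =>
    have hFc : IsClosed F := hF
    let q : ℕ → Past N t →ᵇ ℝ := fun n => BoundedContinuousFunction.ofNormedAddCommGroup
      (fun u => (hFc.apprSeq n u : ℝ))
      (NNReal.continuous_coe.comp (hFc.apprSeq n).continuous) 1 fun u => by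
        simpa using HasOuterApproxClosed.apprSeq_apply_le_one hFc n u
    -- The limit is known to exist only almost everywhere; the limsup is a representative measurable
    -- for the past at every point.
    refine ⟨fun x => limsup (fun n => ENNReal.ofReal
      ((μ[fun x => ∫ y, q n (past t y) ∂(γ : Measure (Path N × Path N)).condKernel x |
          coordFiltration N t]) x)) atTop, ?_, ?_⟩
    · exact Measurable.limsup fun n =>
        ENNReal.measurable_ofReal.comp stronglyMeasurable_condExp.measurable
    · filter_upwards [ae_all_iff.2 fun n => hkey (q n)] with x hx
      have hlim := HasOuterApproxClosed.tendsto_lintegral_apprSeq hFc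
        (((γ : Measure (Path N × Path N)).condKernel x).map (past t))
      rw [Measure.map_apply (measurable_past t) hFc.measurableSet] at hlim
      rw [← hlim.limsup_eq]
      congr 1
      funext n
      rw [← hx n, lintegral_map
        (hFc.apprSeq n).continuous.measurable.coe_nnreal_ennreal (measurable_past t),
        ofReal_integral_eq_lintegral_ofReal]
      · simp [q]
      · exact Integrable.of_bound
          ((q n).continuous.measurable.comp (measurable_past t)).aestronglyMeasurable
          ‖q n‖ (ae_of_all _ fun y => (q n).norm_coe_le_norm _)
      · exact ae_of_all _ fun y => NNReal.coe_nonneg _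
  | compl s hs ih =>
    obtain ⟨f, hf, hfe⟩ := ih
    refine ⟨fun x => 1 - f x, measurable_const.sub hf, ?_⟩
    filter_upwards [hfe] with x hx
    rw [← hx, Set.preimage_compl, prob_compl_eq_one_sub (measurable_past t hs)]
  | iUnion s hd hs ih =>
    choose f hf hfe using ih
    refine ⟨fun x => ⨆ s : Finset ℕ, ∑ n ∈ s, f n x,
      Measurable.iSup fun s => Finset.measurable_fun_sum s fun n _ => hf n, ?_⟩
    filter_upwards [ae_all_iff.2 hfe] with x hx
    rw [Set.preimage_iUnion, measure_iUnion
      (fun i j hij => (hd hij).preimage _) fun n => measurable_past t (hs n)]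
    rw [← ENNReal.tsum_eq_iSup_sum]
    exact tsum_congr hx

/-- The independent coupling is causal. -/
lemma prod_mem_causalPlans (μ ν : Measure (Path N)) [IsProbabilityMeasure μ]
    [IsProbabilityMeasure ν] :
    (⟨μ.prod ν, inferInstance⟩ : ProbabilityMeasure (Path N × Path N)) ∈ causalPlans μ ν := by
  refine mem_causalPlans_of_integral_test_eq_zero ⟨?_, ?_⟩ fun t _ h g _ =>
    ⟨_, ae_eq_refl _, ?_⟩
  · exact Measure.fst_prod
  · exact Measure.snd_prod
  · change ∫ p, _ ∂(μ.prod ν) = 0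
    have := integral_prod_mul (μ := ν) (ν := μ) (fun y : Path N => h (past t y))
      (fun x => g x - (μ[g | coordFiltration N t]) x)
    rw [← integral_prod_swap] at this
    refine this.trans ?_
    rw [integral_sub (g.integrable μ) integrable_condExp,
      integral_condExp ((coordFiltration N).le t), sub_self, mul_zero]

end Causal

end Causality

/-! ### Continuous versions of conditional expectations -/

section ContinuousVersions

variable {N : ℕ}

lemma measurable_future (t : ℕ) : Measurable (future t : Path N → Future N t) :=
  measurable_pi_lambda _ fun _ => measurable_pi_apply _

lemma continuous_glue (t : ℕ) :
    Continuous fun p : Past N t × Future N t => glue t p.1 p.2 := by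
  refine continuous_pi fun i => ?_
  by_cases h : (i : ℕ) < t
  · simp only [glue, h, dif_pos]
    exact (continuous_apply _).comp continuous_fst
  · simp only [glue, h, dif_neg, not_false_eq_true]
    exact (continuous_apply _).comp continuous_snd

@[simp]
lemma glue_past_future (t : ℕ) (x : Path N) : glue t (past t x) (future t x) = x := by
  funext i
  by_cases h : (i : ℕ) < t <;> simp [glue, past, future, h]

/-- The conditional integral `u ↦ ∫ g(u, z) κ(u, dz)`. -/
noncomputable def kernelIntegral {t : ℕ} (κ : Kernel (Past N t) (Future N t)) (g : Path N →ᵇ ℝ)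
    (u : Past N t) : ℝ :=
  ∫ z, g (glue t u z) ∂(κ u)

section KernelIntegral

variable {t : ℕ} {κ : Kernel (Past N t) (Future N t)}

lemma measurable_kernelIntegral [IsMarkovKernel κ] (g : Path N →ᵇ ℝ) :
    Measurable (kernelIntegral κ g) :=
  (StronglyMeasurable.integral_kernel_prod_right
    (f := fun (u : Past N t) z => g (glue t u z)) (κ := κ)
    (g.continuous.comp (continuous_glue t)).stronglyMeasurable).measurable

lemma abs_kernelIntegral_le [IsMarkovKernel κ] (g : Path N →ᵇ ℝ) (u : Past N t) :
    |kernelIntegral κ g u| ≤ ‖g‖ := by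
  simpa using! norm_integral_le_of_norm_le_const (μ := κ u) (f := fun z => g (glue t u z))
    (ae_of_all _ fun z => g.norm_coe_le_norm (glue t u z))

/-- Here `u` enters both the integrand and the measure. Integrating the fixed function `g ∘ glue`
against `δ_u ⊗ κ u` puts all the dependence into a weakly continuous product. -/
lemma continuousOn_kernelIntegral [IsMarkovKernel κ] {s : Set (Past N t)}
    (hκ : ContinuousOn (kernelLaw κ) s) (g : Path N →ᵇ ℝ) :
    ContinuousOn (kernelIntegral κ g) s := by
  let g' : Past N t × Future N t →ᵇ ℝ := g.compContinuous ⟨_, continuous_glue t⟩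
  have hprod : ContinuousOn (fun u => (diracProba u).prod (kernelLaw κ u)) s :=
    ProbabilityMeasure.continuous_prod.comp_continuousOn
      (continuous_diracProba.continuousOn.prodMk hκ)
  refine ((ProbabilityMeasure.continuous_integral_boundedContinuousFunction
    g').comp_continuousOn hprod).congr fun u _ => ?_
  change kernelIntegral κ g u = ∫ p, g' p ∂((Measure.dirac u).prod (κ u))
  rw [integral_prod _ (g'.integrable _), integral_dirac]
  rfl

variable {μ : Measure (Path N)} [IsProbabilityMeasure μ]

/-- Integrating against a version of the conditional kernel gives the conditional expectation. -/
lemma kernelIntegral_ae_eq_condExp [IsMarkovKernel κ]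
    (hκ : (μ.map (fun x => (past t x, future t x))).IsCondKernel κ) (g : Path N →ᵇ ℝ) :
    (fun x => kernelIntegral κ g (past t x)) =ᵐ[μ] μ[g | coordFiltration N t] := by
  have hm := (coordFiltration N).le t
  have hpf : Measurable fun x : Path N => (past t x, future t x) :=
    (measurable_past t).prodMk (measurable_future t)
  have hmeas := measurable_kernelIntegral (κ := κ) g
  have hint : Integrable (fun x => kernelIntegral κ g (past t x)) μ :=
    Integrable.of_bound (hmeas.comp (measurable_past t)).aestronglyMeasurable ‖g‖
      (ae_of_all _ fun x => abs_kernelIntegral_le g _)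
  refine ae_eq_condExp_of_forall_setIntegral_eq hm (g.integrable μ)
    (fun s _ _ => hint.integrableOn) ?_
    (measurable_coordFiltration_comp_past t hmeas).stronglyMeasurable.aestronglyMeasurable
  rintro _ ⟨s, hs, rfl⟩ -
  let g' : Past N t × Future N t →ᵇ ℝ := g.compContinuous ⟨_, continuous_glue t⟩
  set ρ := μ.map (fun x => (past t x, future t x)) with hρ
  have : IsProbabilityMeasure ρ := Measure.isProbabilityMeasure_map hpf.aemeasurable
  have hfst : ρ.fst = μ.map (past t) := Measure.fst_map_prodMk (measurable_future t)
  have hdis : ρ.fst ⊗ₘ κ = ρ := hκ.disintegrate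
  calc ∫ x in past t ⁻¹' s, kernelIntegral κ g (past t x) ∂μ
      = ∫ u in s, kernelIntegral κ g u ∂ρ.fst := by
        rw [hfst, setIntegral_map hs hmeas.aestronglyMeasurable (measurable_past t).aemeasurable]
    _ = ∫ p in s ×ˢ Set.univ, g' p ∂(ρ.fst ⊗ₘ κ) := by
        rw [Measure.setIntegral_compProd hs MeasurableSet.univ (g'.integrable _).integrableOn]
        simp only [Measure.restrict_univ]
        rfl
    _ = ∫ x in past t ⁻¹' s, g x ∂μ := by
        rw [hdis, hρ, setIntegral_map (hs.prod MeasurableSet.univ)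
          g'.continuous.aestronglyMeasurable hpf.aemeasurable]
        have hset : (fun x : Path N => (past t x, future t x)) ⁻¹' (s ×ˢ Set.univ)
            = past t ⁻¹' s := by ext x; simp
        rw [hset]
        refine integral_congr_ae (ae_of_all _ fun x => ?_)
        change g (glue t (past t x) (future t x)) = g x
        rw [glue_past_future]

end KernelIntegral

/-- Functions which are continuous on the projection of the support and agree almost everywhere
agree on that projection. -/
lemma eqOn_of_ae_eq_comp_past {μ : Measure (Path N)} {t : ℕ} {f g : Past N t → ℝ}
    (hf : ContinuousOn f (past t '' μ.support)) (hg : ContinuousOn g (past t '' μ.support))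
    (h : (fun x => f (past t x)) =ᵐ[μ] fun x => g (past t x)) :
    Set.EqOn f g (past t '' μ.support) := by
  rintro _ ⟨x, hx, rfl⟩
  by_contra hne
  have hmaps : Set.MapsTo (past t) μ.support (past t '' μ.support) := Set.mapsTo_image _ _
  have hcf := (hf.comp (continuous_past t).continuousOn hmaps) x hx
  have hcg := (hg.comp (continuous_past t).continuousOn hmaps) x hx
  -- The disagreement persists on a relative neighbourhood of a support point; together with the
  -- null complement of the support this would be a null neighbourhood.
  have hev : ∀ᶠ x' in 𝓝[μ.support] x, f (past t x') ≠ g (past t x') :=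
    ((hcf.sub hcg).tendsto.eventually_ne (sub_ne_zero.2 hne)).mono fun x' hx' => sub_ne_zero.1 hx'
  rw [eventually_nhdsWithin_iff] at hev
  have hpos := (Measure.mem_support_iff_forall x).1 hx _ hev
  refine hpos.ne' (measure_mono_null ?_
    (measure_union_null (Measure.measure_compl_support (μ := μ)) h))
  intro x' hx'
  by_cases hs : x' ∈ μ.support
  · exact Or.inr (hx' hs)
  · exact Or.inl hs

/-- For compactly supported `g`, the conditional expectation given the first `t` coordinates has a
version which is a bounded continuous function on all of `ℝ^t`. Compactness makes the conditional
integral vanish near the boundary points missing from the projection of the support. -/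
lemma exists_boundedContinuous_ae_eq_condExp {μ : Measure (Path N)} [IsProbabilityMeasure μ]
    {t : ℕ} {κ : Kernel (Past N t) (Future N t)} (hκ : IsWeaklyContinuousVersion μ t κ)
    (g : Path N →ᵇ ℝ) (hg : HasCompactSupport g) :
    ∃ M : Past N t →ᵇ ℝ, (fun x => M (past t x)) =ᵐ[μ] μ[g | coordFiltration N t] := by
  obtain ⟨_, hcond, hcont⟩ := hκ
  set G := kernelIntegral κ g with hG
  have hGae := kernelIntegral_ae_eq_condExp hcond g
  have hGcont : ContinuousOn G (past t '' μ.support) := continuousOn_kernelIntegral hcont g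
  -- Compactness of the support of `g` makes `K` closed, although the projection of the support of
  -- `μ` need not be. Outside `K` the function `g` vanishes, hence so does `G`, almost surely.
  let K : Set (Past N t) := past t '' (μ.support ∩ tsupport g)
  have hK : IsClosed K :=
    ((hg.isCompact.inter_left Measure.isClosed_support).image (continuous_past t)).isClosed
  let A : Set (Past N t) := {u | u ∈ past t '' μ.support ∧ (u ∉ K → G u = 0)}
  have hAae : ∀ᵐ x ∂μ, past t x ∈ A := by
    have hs : MeasurableSet[coordFiltration N t] (past t ⁻¹' Kᶜ) :=
      ⟨Kᶜ, hK.measurableSet.compl, rfl⟩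
    have hs' : MeasurableSet (past t ⁻¹' Kᶜ) := (coordFiltration N).le t _ hs
    have hzero : g =ᵐ[μ.restrict (past t ⁻¹' Kᶜ)] 0 := by
      rw [Filter.EventuallyEq, ae_restrict_iff' hs']
      filter_upwards [Measure.support_mem_ae (μ := μ)] with x hx hxK
      by_contra hne
      exact hxK ⟨x, ⟨hx, subset_tsupport _ hne⟩, rfl⟩
    have hcz := condExp_ae_eq_restrict_zero hs hzero
    rw [Filter.EventuallyEq, ae_restrict_iff' hs'] at hcz
    filter_upwards [hcz, hGae, Measure.support_mem_ae (μ := μ)] with x h1 h2 h3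
    exact ⟨⟨x, h3, rfl⟩, fun hx => h2.trans (h1 hx)⟩
  have hGA : ContinuousOn G A := hGcont.mono fun u hu => hu.1
  have hlim : ∀ u ∈ closure A, ∃ y, Tendsto G (𝓝[A] u) (𝓝 y) := by
    intro u _
    by_cases hu : u ∈ past t '' μ.support
    · exact ⟨G u, (hGcont u hu).mono fun v hv => hv.1⟩
    -- A limit point outside the projection is off the closed set `K`, so `G` is zero on `A` near it
    -- and extends by zero.
    · have huK : u ∉ K := fun h => hu (Set.image_mono Set.inter_subset_left h)
      refine ⟨0, tendsto_const_nhds.congr' ?_⟩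
      filter_upwards [self_mem_nhdsWithin, mem_nhdsWithin_of_mem_nhds (hK.isOpen_compl.mem_nhds huK)]
        with v hv hvK
      exact (hv.2 hvK).symm
  have hext := continuousOn_extendFrom (f := G) (A := A) (B := closure A) subset_rfl hlim
  let f : closure A →ᵇ ℝ := BoundedContinuousFunction.ofNormedAddCommGroup
    (fun u => extendFrom A G u) (continuousOn_iff_continuous_domRestrict.1 hext) ‖g‖ fun u => by
      have := mem_closure_iff_nhdsWithin_neBot.1 u.2
      exact le_of_tendsto (tendsto_extendFrom (hlim u u.2)).norm
        (Eventually.of_forall fun v => abs_kernelIntegral_le g v)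
  -- Tietze extension from the closure of `A` to all of `ℝ^t`.
  obtain ⟨M, -, hM⟩ := BoundedContinuousFunction.exists_norm_eq_domRestrict_eq_of_closed f
    isClosed_closure
  refine ⟨M, ?_⟩
  filter_upwards [hAae, hGae] with x hx hx'
  rw [← hx']
  have h1 : M (past t x) = f ⟨past t x, subset_closure hx⟩ := by rw [← hM]; rfl
  rw [h1]
  exact extendFrom_extends hGA _ hx

/-- For compactly supported `g` there is a martingale of bounded continuous functions with
terminal value `g`. -/
lemma exists_continuous_martingale {μ : Measure (Path N)} [IsProbabilityMeasure μ]
    (hμ : SuccessivelyWeaklyContinuous μ) (g : Path N →ᵇ ℝ) (hg : HasCompactSupport g) :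
    ∃ M : ∀ t : ℕ, Past N t →ᵇ ℝ,
      (∀ t, (fun x => M t (past t x)) =ᵐ[μ] μ[g | coordFiltration N t]) ∧
      Martingale (fun t x => M t (past t x)) (coordFiltration N) μ ∧
      ∀ x, M N (past N x) = g x := by
  have hex : ∀ t, ∃ M : Past N t →ᵇ ℝ,
      (fun x => M (past t x)) =ᵐ[μ] μ[g | coordFiltration N t] ∧
      (N ≤ t → ∀ x, M (past t x) = g x) := by
    intro t
    rcases lt_or_ge t N with ht | ht
    · obtain ⟨κ, hκ⟩ := hμ t ht
      obtain ⟨M, hM⟩ := exists_boundedContinuous_ae_eq_condExp hκ g hg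
      exact ⟨M, hM, fun h => absurd ht h.not_gt⟩
    · refine ⟨g.compContinuous ⟨fun u i => u ⟨i, i.2.trans_le ht⟩,
        continuous_pi fun i => continuous_apply _⟩, ?_, fun _ x => rfl⟩
      rw [condExp_of_stronglyMeasurable ((coordFiltration N).le t) _ (g.integrable μ)]
      · exact ae_eq_refl _
      · rw [coordFiltration_eq_of_le ht]
        exact g.continuous.stronglyMeasurable
  choose M hM hMN using hex
  refine ⟨M, hM, ⟨fun t => ?_, fun s t hst => ?_⟩, hMN N le_rfl⟩
  · exact (measurable_coordFiltration_comp_past t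
      (M t).continuous.measurable).stronglyMeasurable
  · exact (condExp_congr_ae (hM t)).trans
      (((martingale_condExp (g : Path N → ℝ) (coordFiltration N) μ).2 s t hst).trans (hM s).symm)

section Tests

variable {μ ν : Measure (Path N)} [IsProbabilityMeasure μ]

/-- Each summand is an elementary test with `g = M (t + 1)`, whose conditional expectation is `M t`
by the martingale property. -/
lemma classS_annihilated {S : Path N × Path N → ℝ} (hS : S ∈ classS μ)
    {γ : ProbabilityMeasure (Path N × Path N)} (hγ : γ ∈ causalPlans μ ν) :
    Integrable S (γ : Measure (Path N × Path N)) ∧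
      ∫ p, S p ∂(γ : Measure (Path N × Path N)) = 0 := by
  induction hS using Submodule.span_induction with
  | mem S hS =>
    obtain ⟨H, M, hM, rfl⟩ := hS
    have key : ∀ t ∈ Finset.range N, _ := fun t ht =>
      integral_test_eq_zero hγ (Finset.mem_range.1 ht).le (H t)
        (g := fun x => M (t + 1) (past (t + 1) x)) (G := fun x => M t (past t x))
        (hM.integrable (t + 1)) (hM.2 t (t + 1) t.le_succ).symm
    refine ⟨integrable_finsetSum _ fun t ht => (key t ht).1, ?_⟩
    rw [integral_finsetSum _ fun t ht => (key t ht).1]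
    exact Finset.sum_eq_zero fun t ht => (key t ht).2
  | zero => exact ⟨integrable_zero _ _ _, integral_zero _ _⟩
  | add f g _ _ hf hg =>
    exact ⟨hf.1.add hg.1, by
      rw [integral_add' hf.1 hg.1, hf.2, hg.2, add_zero]⟩
  | smul a f _ hf =>
    exact ⟨hf.1.smul a, by
      simp only [Pi.smul_apply]
      rw [integral_smul, hf.2, smul_zero]⟩

lemma classF_annihilated {F : Path N × Path N → ℝ} (hF : F ∈ classF μ)
    {γ : ProbabilityMeasure (Path N × Path N)} (hγ : γ ∈ causalPlans μ ν) :
    Integrable F (γ : Measure (Path N × Path N)) ∧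
      ∫ p, F p ∂(γ : Measure (Path N × Path N)) = 0 := by
  induction hF using Submodule.span_induction with
  | mem F hF =>
    obtain ⟨κ, h, g, hκ, rfl⟩ := hF
    have key : ∀ t ∈ Finset.range N,
        Integrable (fun p : Path N × Path N =>
          h t (past t p.2) * (g t p.1 - kernelIntegral (κ t) (g t) (past t p.1)))
          (γ : Measure (Path N × Path N)) ∧
        ∫ p, h t (past t p.2) * (g t p.1 - kernelIntegral (κ t) (g t) (past t p.1))
          ∂(γ : Measure (Path N × Path N)) = 0 := fun t ht => by
      obtain ⟨_, hcond, -⟩ := hκ t (Finset.mem_range.1 ht)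
      exact integral_test_eq_zero hγ (Finset.mem_range.1 ht).le (h t)
        ((g t).integrable μ) (kernelIntegral_ae_eq_condExp hcond (g t))
    refine ⟨integrable_finsetSum _ fun t ht => (key t ht).1, ?_⟩
    exact (integral_finsetSum _ fun t ht => (key t ht).1).trans
      (Finset.sum_eq_zero fun t ht => (key t ht).2)
  | zero => exact ⟨integrable_zero _ _ _, integral_zero _ _⟩
  | add f g _ _ hf hg =>
    exact ⟨hf.1.add hg.1, by
      rw [integral_add' hf.1 hg.1, hf.2, hg.2, add_zero]⟩
  | smul a f _ hf =>
    exact ⟨hf.1.smul a, by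
      simp only [Pi.smul_apply]
      rw [integral_smul, hf.2, smul_zero]⟩

/-- `W` contains, up to values off the support of `μ`, all elementary causality tests with
compactly supported `g`. -/
def ContainsTests (μ : Measure (Path N)) (W : Submodule ℝ (Path N × Path N → ℝ)) : Prop :=
  ∀ t < N, ∀ (h : Past N t →ᵇ ℝ) (g : Path N →ᵇ ℝ), HasCompactSupport g →
    ∃ M : Past N t →ᵇ ℝ, (fun x => M (past t x)) =ᵐ[μ] μ[g | coordFiltration N t] ∧
      ∃ F ∈ W, ∀ x ∈ μ.support, ∀ y, F (x, y) = h (past t y) * (g x - M (past t x))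

/-- Start the integrand at time `t` and hold it at `h`: the increments telescope from `M t` to the
terminal value `g`. -/
lemma containsTests_classS (hμ : SuccessivelyWeaklyContinuous μ) :
    ContainsTests μ (classS μ) := by
  intro t ht h g hg
  obtain ⟨M, hM, hmart, hMN⟩ := exists_continuous_martingale hμ g hg
  let H : ∀ s : ℕ, Past N s →ᵇ ℝ := fun s =>
    if hts : t ≤ s then h.compContinuous
      ⟨fun u i => u ⟨i.1, i.2.trans_le hts⟩, continuous_pi fun i => continuous_apply _⟩
    else 0
  refine ⟨M t, hM t, _, Submodule.subset_span ⟨H, M, hmart, rfl⟩, fun x _ y => ?_⟩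
  have h1 : ∀ s ∈ Finset.range N,
      H s (past s y) * (M (s + 1) (past (s + 1) x) - M s (past s x))
        = if t ≤ s then h (past t y) * (M (s + 1) (past (s + 1) x) - M s (past s x)) else 0 := by
    intro s _
    by_cases hts : t ≤ s
    · simp only [H, hts, dif_pos, if_true]
      rfl
    · simp [H, hts]
  have h2 : (Finset.range N).filter (fun s => t ≤ s) = Finset.Ico t N := by
    ext s; simp [and_comm]
  simp only
  rw [Finset.sum_congr rfl h1, ← Finset.sum_filter, h2, ← Finset.mul_sum,
    Finset.sum_Ico_sub (fun s => M s (past s x)) ht.le, hMN]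

/-- A single summand is kept. The kernel integral and its extension `M` agree on the projection of
the support, which is why equality is asked only for `x` in the support. -/
lemma containsTests_classF (hμ : SuccessivelyWeaklyContinuous μ) :
    ContainsTests μ (classF μ) := by
  intro t ht h g hg
  have hex : ∀ s, ∃ κ : Kernel (Past N s) (Future N s),
      s < N → IsWeaklyContinuousVersion μ s κ := by
    intro s
    by_cases hs : s < N
    · obtain ⟨κ, hκ⟩ := hμ s hs
      exact ⟨κ, fun _ => hκ⟩
    · exact ⟨0, fun h => absurd h hs⟩
  choose κ hκ using hex
  obtain ⟨M, hM⟩ := exists_boundedContinuous_ae_eq_condExp (hκ t ht) g hg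
  refine ⟨M, hM, _, Submodule.subset_span ⟨κ, Pi.single t h, fun _ => g, hκ, rfl⟩,
    fun x hx y => ?_⟩
  obtain ⟨_, hcond, hcont⟩ := hκ t ht
  have heq : kernelIntegral (κ t) g (past t x) = M (past t x) :=
    eqOn_of_ae_eq_comp_past (continuousOn_kernelIntegral hcont g) M.continuous.continuousOn
      ((kernelIntegral_ae_eq_condExp hcond g).trans hM.symm) ⟨x, hx, rfl⟩
  simp only
  rw [Finset.sum_eq_single_of_mem t (Finset.mem_range.2 ht)]
  · rw [Pi.single_eq_same, ← heq]
    rfl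
  · intro s _ hs
    rw [Pi.single_eq_of_ne hs]
    simp

end Tests

end ContinuousVersions

/-! ### Weak duality, the super-replication cone and attainment -/

section Duality

variable {N : ℕ} {μ ν : Measure (Path N)}

lemma ae_mem_support_of_mem_plans {γ : ProbabilityMeasure (Path N × Path N)}
    (hγ : γ ∈ plans μ ν) :
    ∀ᵐ p ∂(γ : Measure (Path N × Path N)), p.1 ∈ μ.support ∧ p.2 ∈ ν.support := by
  have h1 : ∀ᵐ x ∂(γ : Measure (Path N × Path N)).fst, x ∈ μ.support := by
    rw [hγ.1]; exact Measure.support_mem_ae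
  have h2 : ∀ᵐ y ∂(γ : Measure (Path N × Path N)).snd, y ∈ ν.support := by
    rw [hγ.2]; exact Measure.support_mem_ae
  exact (ae_of_ae_map measurable_fst.aemeasurable h1).and
    (ae_of_ae_map measurable_snd.aemeasurable h2)

lemma integral_fst_of_mem_plans {γ : ProbabilityMeasure (Path N × Path N)}
    (hγ : γ ∈ plans μ ν) (Φ : Path N →ᵇ ℝ) :
    ∫ p, Φ p.1 ∂(γ : Measure (Path N × Path N)) = ∫ x, Φ x ∂μ := by
  rw [← hγ.1, Measure.fst, integral_map measurable_fst.aemeasurable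
    Φ.continuous.aestronglyMeasurable]

lemma integral_snd_of_mem_plans {γ : ProbabilityMeasure (Path N × Path N)}
    (hγ : γ ∈ plans μ ν) (Ψ : Path N →ᵇ ℝ) :
    ∫ p, Ψ p.2 ∂(γ : Measure (Path N × Path N)) = ∫ y, Ψ y ∂ν := by
  rw [← hγ.2, Measure.snd, integral_map measurable_snd.aemeasurable
    Ψ.continuous.aestronglyMeasurable]

/-- Weak duality. -/
lemma dualValue_le_extIntegral {c : Path N × Path N → EReal}
    {W : Submodule ℝ (Path N × Path N → ℝ)} {γ : ProbabilityMeasure (Path N × Path N)}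
    (hγ : γ ∈ plans μ ν)
    (hW : ∀ F ∈ W, Integrable F (γ : Measure (Path N × Path N)) ∧
      ∫ p, F p ∂(γ : Measure (Path N × Path N)) = 0) :
    dualValue μ ν c W ≤ extIntegral (γ : Measure (Path N × Path N)) c := by
  refine iSup_le fun Φ => iSup_le fun Ψ => iSup_le fun F => iSup_le fun hF => iSup_le fun hle => ?_
  obtain ⟨hFi, hF0⟩ := hW F hF
  have hsum := (directSum Φ Ψ).integrable (γ : Measure (Path N × Path N))
  have hΦ := (Φ.compContinuous ⟨Prod.fst, continuous_fst⟩ : Path N × Path N →ᵇ ℝ).integrable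
    (γ : Measure (Path N × Path N))
  have hΨ := (Ψ.compContinuous ⟨Prod.snd, continuous_snd⟩ : Path N × Path N →ᵇ ℝ).integrable
    (γ : Measure (Path N × Path N))
  have heq : ∫ x, Φ x ∂μ + ∫ y, Ψ y ∂ν
      = ∫ p, (directSum Φ Ψ p - F p) ∂(γ : Measure (Path N × Path N)) := by
    rw [integral_sub hsum hFi, hF0, sub_zero, ← integral_fst_of_mem_plans hγ,
      ← integral_snd_of_mem_plans hγ]
    exact (integral_add hΦ hΨ).symm
  rw [heq, ← extIntegral_coe (f := fun p => directSum Φ Ψ p - F p) (hsum.sub hFi)]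
  refine extIntegral_mono_ae ?_
  filter_upwards [ae_mem_support_of_mem_plans hγ] with p hp
  rw [EReal.coe_sub, EReal.sub_le_iff_le_add (Or.inl (EReal.coe_ne_bot _))
    (Or.inl (EReal.coe_ne_top _))]
  exact hle p.1 hp.1 p.2 hp.2

lemma le_dualValue {c : Path N × Path N → EReal} {W : Submodule ℝ (Path N × Path N → ℝ)}
    {Φ Ψ : Path N →ᵇ ℝ} {F : Path N × Path N → ℝ} (hF : F ∈ W)
    (hle : ∀ x ∈ μ.support, ∀ y ∈ ν.support,
      ((Φ x + Ψ y : ℝ) : EReal) ≤ c (x, y) + ((F (x, y) : ℝ) : EReal)) :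
    ((∫ x, Φ x ∂μ + ∫ y, Ψ y ∂ν : ℝ) : EReal) ≤ dualValue μ ν c W :=
  le_iSup_of_le Φ <| le_iSup_of_le Ψ <| le_iSup_of_le F <| le_iSup_of_le hF <|
    le_iSup_of_le hle le_rfl

section StrongDuality

variable [IsProbabilityMeasure μ] [IsProbabilityMeasure ν]

/-- The cone of pairs `(f, a)` such that `f` is super-replicated at cost `a` by potentials, test
functions in `W` and units of `c`, each of which is priced at `D`. -/
def superCone (μ ν : Measure (Path N)) [IsProbabilityMeasure μ] [IsProbabilityMeasure ν]
    (c : Path N × Path N → EReal)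
    (W : Submodule ℝ (Path N × Path N → ℝ)) (D : ℝ) :
    PointedCone ℝ ((Path N × Path N →ᵇ ℝ) × ℝ) where
  carrier := {q | ∃ (Φ Ψ : Path N →ᵇ ℝ) (F : Path N × Path N → ℝ) (l : ℝ), F ∈ W ∧ 0 ≤ l ∧
    -- Quantifying over real `r ≥ c (x, y)` keeps the inequality in `ℝ`; where `c = ⊤` there is no
    -- constraint, even for `l = 0`.
    (∀ x ∈ μ.support, ∀ y ∈ ν.support, ∀ r : ℝ, c (x, y) ≤ r →
      q.1 (x, y) ≤ Φ x + Ψ y + F (x, y) + l * r) ∧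
    q.2 = ∫ x, Φ x ∂μ + ∫ y, Ψ y ∂ν + l * D}
  add_mem' := by
    rintro q q' ⟨Φ, Ψ, F, l, hF, hl, hle, heq⟩ ⟨Φ', Ψ', F', l', hF', hl', hle', heq'⟩
    refine ⟨Φ + Φ', Ψ + Ψ', F + F', l + l', W.add_mem hF hF', add_nonneg hl hl',
      fun x hx y hy r hr => ?_, ?_⟩
    · have h1 := hle x hx y hy r hr
      have h2 := hle' x hx y hy r hr
      simp only [Prod.fst_add, BoundedContinuousFunction.coe_add, Pi.add_apply]
      linarith
    · simp only [Prod.snd_add, BoundedContinuousFunction.coe_add, Pi.add_apply]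
      rw [heq, heq', integral_add (Φ.integrable μ) (Φ'.integrable μ),
        integral_add (Ψ.integrable ν) (Ψ'.integrable ν)]
      ring
  zero_mem' := ⟨0, 0, 0, 0, W.zero_mem, le_rfl, by simp, by simp⟩
  smul_mem' := by
    rintro ⟨a, ha⟩ q ⟨Φ, Ψ, F, l, hF, hl, hle, heq⟩
    refine ⟨a • Φ, a • Ψ, a • F, a * l, W.smul_mem a hF, mul_nonneg ha hl,
      fun x hx y hy r hr => ?_, ?_⟩
    · have h1 := mul_le_mul_of_nonneg_left (hle x hx y hy r hr) ha
      change a * q.1 (x, y) ≤ a * Φ x + a * Ψ y + a * F (x, y) + a * l * r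
      linarith
    · change a * q.2 = ∫ x, a * Φ x ∂μ + ∫ y, a * Ψ y ∂ν + a * l * D
      rw [heq, integral_const_mul, integral_const_mul]
      ring

lemma mem_superCone {c : Path N × Path N → EReal}
    {W : Submodule ℝ (Path N × Path N → ℝ)} {D : ℝ} {f : Path N × Path N →ᵇ ℝ} {a : ℝ} :
    (f, a) ∈ superCone μ ν c W D ↔
      ∃ (Φ Ψ : Path N →ᵇ ℝ) (F : Path N × Path N → ℝ) (l : ℝ), F ∈ W ∧ 0 ≤ l ∧
        (∀ x ∈ μ.support, ∀ y ∈ ν.support, ∀ r : ℝ, c (x, y) ≤ r →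
          f (x, y) ≤ Φ x + Ψ y + F (x, y) + l * r) ∧
        a = ∫ x, Φ x ∂μ + ∫ y, Ψ y ∂ν + l * D := Iff.rfl

/-- Super-replicating zero has nonnegative cost. -/
lemma nonneg_of_zero_mem_superCone {c : Path N × Path N → EReal} {b : ℝ}
    (hb : ∀ p, (b : EReal) ≤ c p) {W : Submodule ℝ (Path N × Path N → ℝ)} {D : ℝ}
    (hD : dualValue μ ν c W = D) {a : ℝ}
    (ha : ((0 : Path N × Path N →ᵇ ℝ), a) ∈ superCone μ ν c W D) : 0 ≤ a := by
  obtain ⟨Φ, Ψ, F, l, hF, hl, hle, rfl⟩ := mem_superCone.1 ha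
  -- Adding `ε * (c - b) ≥ 0` makes the coefficient of `c` positive even when `l = 0`. Dividing by
  -- `l + ε` gives an admissible dual triple, worth at most `D`; then `ε → 0`.
  have key : ∀ ε > 0, 0 ≤ ∫ x, Φ x ∂μ + ∫ y, Ψ y ∂ν + l * D + ε * (D - b) := by
    intro ε hε
    have hl' : 0 < l + ε := by linarith
    let Φ' : Path N →ᵇ ℝ := (-(l + ε)⁻¹) • (Φ - BoundedContinuousFunction.const _ (ε * b))
    let Ψ' : Path N →ᵇ ℝ := (-(l + ε)⁻¹) • Ψ
    have h := le_dualValue (μ := μ) (ν := ν) (c := c) (Φ := Φ') (Ψ := Ψ')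
      (W.smul_mem (l + ε)⁻¹ hF) (fun x hx y hy => by
        induction hr : c (x, y) with
        | bot => exact absurd (hb (x, y)) (by rw [hr]; simp)
        | top => rw [EReal.top_add_of_ne_bot (EReal.coe_ne_bot _)]; exact le_top
        | coe r =>
          have h1 := hle x hx y hy r hr.le
          have h2 : b ≤ r := by
            have := hb (x, y); rw [hr] at this; exact EReal.coe_le_coe_iff.1 this
          rw [← EReal.coe_add, EReal.coe_le_coe_iff]
          change -(l + ε)⁻¹ * (Φ x - ε * b) + -(l + ε)⁻¹ * Ψ y ≤ r + (l + ε)⁻¹ * F (x, y)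
          have h3 : 0 ≤ (l + ε)⁻¹ * (Φ x + Ψ y + F (x, y) + l * r + ε * (r - b)) := by
            refine mul_nonneg (inv_nonneg.2 hl'.le) ?_
            have := mul_nonneg hε.le (sub_nonneg.2 h2)
            simp only [BoundedContinuousFunction.coe_zero, Pi.zero_apply] at h1
            linarith
          have h4 : (l + ε)⁻¹ * (l + ε) = 1 := inv_mul_cancel₀ hl'.ne'
          have h5 : (l + ε)⁻¹ * (l + ε) * r = r := by rw [h4, one_mul]
          linarith)
    rw [hD, EReal.coe_le_coe_iff] at h
    have h1 : ∫ x, Φ' x ∂μ = -(l + ε)⁻¹ * (∫ x, Φ x ∂μ - ε * b) := by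
      change ∫ x, -(l + ε)⁻¹ * (Φ x - ε * b) ∂μ = _
      rw [integral_const_mul, integral_sub (Φ.integrable μ) (integrable_const _)]
      simp
    have h2 : ∫ y, Ψ' y ∂ν = -(l + ε)⁻¹ * ∫ y, Ψ y ∂ν := by
      change ∫ y, -(l + ε)⁻¹ * Ψ y ∂ν = _
      rw [integral_const_mul]
    rw [h1, h2] at h
    have h3 := mul_le_mul_of_nonneg_left h hl'.le
    have h4 : (l + ε) * (l + ε)⁻¹ = 1 := mul_inv_cancel₀ hl'.ne'
    have h5 : (l + ε) * (-(l + ε)⁻¹ * (∫ x, Φ x ∂μ - ε * b) + -(l + ε)⁻¹ * ∫ y, Ψ y ∂ν)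
        = -((∫ x, Φ x ∂μ - ε * b) + ∫ y, Ψ y ∂ν) := by
      linear_combination (-(∫ x, Φ x ∂μ - ε * b) - ∫ y, Ψ y ∂ν) * h4
    rw [h5] at h3
    linarith
  have hlim : Tendsto (fun ε : ℝ => ∫ x, Φ x ∂μ + ∫ y, Ψ y ∂ν + l * D + ε * (D - b)) (𝓝[>] 0)
      (𝓝 (∫ x, Φ x ∂μ + ∫ y, Ψ y ∂ν + l * D + 0 * (D - b))) :=
    ((continuous_const.add (continuous_id.mul continuous_const)).tendsto 0).mono_left
      nhdsWithin_le_nhds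
  rw [zero_mul, add_zero] at hlim
  exact ge_of_tendsto hlim (eventually_mem_nhdsWithin.mono key)

/-- Strong duality: a finite dual value is attained by some causal plan. -/
lemma exists_causalPlan_extIntegral_le {c : Path N × Path N → EReal}
    (hc : LowerSemicontinuous c) {b : ℝ} (hb : ∀ p, (b : EReal) ≤ c p)
    {W : Submodule ℝ (Path N × Path N → ℝ)} (hW : ContainsTests μ W) {D : ℝ}
    (hD : dualValue μ ν c W = D) :
    ∃ γ ∈ causalPlans μ ν, extIntegral (γ : Measure (Path N × Path N)) c ≤ D := by
  obtain ⟨L, hL⟩ := exists_linearMap_le_of_pointedCone (superCone μ ν c W D)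
    (fun a ha => nonneg_of_zero_mem_superCone hb hD ha) (fun f =>
      ⟨_, mem_superCone.2 ⟨BoundedContinuousFunction.const _ ‖f‖, 0, 0, 0, W.zero_mem, le_rfl,
        fun x _ y _ r _ => by simpa using (le_abs_self _).trans (f.norm_coe_le_norm (x, y)),
        rfl⟩⟩)
  have hLle : ∀ (f : Path N × Path N →ᵇ ℝ) (Φ Ψ : Path N →ᵇ ℝ), ∀ F ∈ W,
      (∀ x ∈ μ.support, ∀ y ∈ ν.support, f (x, y) ≤ Φ x + Ψ y + F (x, y)) →
      L f ≤ ∫ x, Φ x ∂μ + ∫ y, Ψ y ∂ν := by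
    intro f Φ Ψ F hF hle
    refine hL f _ (mem_superCone.2 ⟨Φ, Ψ, F, 0, hF, le_rfl, fun x hx y hy r _ => ?_, by simp⟩)
    simpa using hle x hx y hy
  have hpos : ∀ f : Path N × Path N →ᵇ ℝ, (∀ z, 0 ≤ f z) → 0 ≤ L f := by
    intro f hf
    have := hLle (-f) 0 0 0 W.zero_mem fun x _ y _ => by simpa using hf (x, y)
    simpa using this
  have hmarg : ∀ Φ Ψ : Path N →ᵇ ℝ, L (directSum Φ Ψ) = ∫ x, Φ x ∂μ + ∫ y, Ψ y ∂ν := by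
    intro Φ Ψ
    refine le_antisymm (hLle _ Φ Ψ 0 W.zero_mem fun x _ y _ => by simp) ?_
    have := hLle (-directSum Φ Ψ) (-Φ) (-Ψ) 0 W.zero_mem fun x _ y _ => by
      simp only [BoundedContinuousFunction.coe_neg, Pi.neg_apply, directSum_apply, Pi.zero_apply]
      linarith
    simp only [map_neg, BoundedContinuousFunction.coe_neg, Pi.neg_apply, integral_neg] at this
    linarith
  obtain ⟨γ, hfst, hsnd, hγ⟩ := exists_coupling_integral_eq μ ν L hpos hmarg
  refine ⟨γ, mem_causalPlans_of_integral_test_eq_zero ⟨hfst, hsnd⟩ fun t ht h g hg => ?_, ?_⟩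
  · obtain ⟨M, hM, F, hF, hFeq⟩ := hW t ht h g hg
    refine ⟨_, hM, ?_⟩
    let w : Path N × Path N →ᵇ ℝ :=
      h.compContinuous ⟨fun p : Path N × Path N => past t p.2,
        (continuous_past t).comp continuous_snd⟩ *
      (g.compContinuous ⟨Prod.fst, continuous_fst⟩ -
        M.compContinuous ⟨fun p : Path N × Path N => past t p.1,
          (continuous_past t).comp continuous_fst⟩)
    have hw : ∀ p, w p = h (past t p.2) * (g p.1 - M (past t p.1)) := fun p => rfl
    -- On the supports both `w` and `-w` are replicated by elements of `W`, at cost zero.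
    refine (hγ w).symm.trans (le_antisymm ?_ ?_)
    · simpa using hLle w 0 0 F hF fun x hx y _ => by
        simp [hw, hFeq x hx y]
    · simpa using hLle (-w) 0 0 (-F) (W.neg_mem hF) fun x hx y _ => by
        simp [hw, hFeq x hx y]
  · refine extIntegral_le_of_forall_boundedContinuous hc hb fun f hf => ?_
    rw [← hγ f]
    -- One unit of `c` super-replicates any `f ≤ c`, at price `D`.
    have := hL f (1 * D) (mem_superCone.2 ⟨0, 0, 0, 1, W.zero_mem, zero_le_one,
      fun x _ y _ r hr => by
        simpa using EReal.coe_le_coe_iff.1 ((hf (x, y)).trans hr), by simp⟩)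
    simpa using this

/-- Duality and attainment for a space of test functions which vanish on causal plans and which
are rich enough to detect causality. -/
lemma attainment_and_duality {c : Path N × Path N → EReal}
    (hc : LowerSemicontinuous c) (hb : ∃ b : ℝ, ∀ p, (b : EReal) ≤ c p)
    {W : Submodule ℝ (Path N × Path N → ℝ)} (hW : ContainsTests μ W)
    (hW0 : ∀ F ∈ W, ∀ γ ∈ causalPlans μ ν, Integrable F (γ : Measure (Path N × Path N)) ∧
      ∫ p, F p ∂(γ : Measure (Path N × Path N)) = 0) :
    (∃ γ ∈ causalPlans μ ν,
      extIntegral (γ : Measure (Path N × Path N)) c = causalValue μ ν c) ∧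
    causalValue μ ν c = dualValue μ ν c W := by
  obtain ⟨b, hb⟩ := hb
  have hweak : ∀ γ ∈ causalPlans μ ν,
      dualValue μ ν c W ≤ extIntegral (γ : Measure (Path N × Path N)) c := fun γ hγ =>
    dualValue_le_extIntegral hγ.1 fun F hF => hW0 F hF γ hγ
  have hweak' : dualValue μ ν c W ≤ causalValue μ ν c := le_iInf₂ hweak
  suffices ∃ γ ∈ causalPlans μ ν,
      extIntegral (γ : Measure (Path N × Path N)) c ≤ dualValue μ ν c W by
    obtain ⟨γ, hγ, hle⟩ := this
    have hval : causalValue μ ν c ≤ extIntegral (γ : Measure (Path N × Path N)) c :=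
      iInf₂_le γ hγ
    exact ⟨⟨γ, hγ, le_antisymm (hle.trans hweak') hval⟩, le_antisymm (hval.trans hle) hweak'⟩
  -- The constant potential `b` is admissible, so the dual value is never `⊥`.
  have hbot : (b : EReal) ≤ dualValue μ ν c W := by
    have := le_dualValue (μ := μ) (ν := ν) (c := c) (Φ := BoundedContinuousFunction.const _ b)
      (Ψ := 0) W.zero_mem fun x _ y _ => by simpa using hb (x, y)
    simpa using this
  induction hD : dualValue μ ν c W with
  | bot => rw [hD] at hbot; simp at hbot
  -- With infinite dual value any causal plan will do; the independent coupling shows that one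
  -- exists.
  | top => exact ⟨_, prod_mem_causalPlans μ ν, le_top⟩
  | coe D => exact exists_causalPlan_extIntegral_le hc hb hW hD

end StrongDuality

end Duality

end CausalOT

theorem mainTheorem1 {N : ℕ} (μ ν : Measure (CausalOT.Path N))
    [IsProbabilityMeasure μ] [IsProbabilityMeasure ν]
    (hμ : CausalOT.SuccessivelyWeaklyContinuous μ)
    (c : CausalOT.Path N × CausalOT.Path N → EReal)
    (hc : LowerSemicontinuous c)
    (hc_bdd : ∃ b : ℝ, ∀ p, (b : EReal) ≤ c p) :
    (∃ γ ∈ CausalOT.causalPlans μ ν,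
      CausalOT.extIntegral (γ : Measure (CausalOT.Path N × CausalOT.Path N)) c
        = CausalOT.causalValue μ ν c) ∧
    CausalOT.causalValue μ ν c = CausalOT.dualValue μ ν c (CausalOT.classF μ) ∧
    CausalOT.causalValue μ ν c = CausalOT.dualValue μ ν c (CausalOT.classS μ) := by
  obtain ⟨hatt, hF⟩ := CausalOT.attainment_and_duality (ν := ν) hc hc_bdd
    (CausalOT.containsTests_classF hμ) fun F hF γ hγ => CausalOT.classF_annihilated hF hγ
  exact ⟨hatt, hF, (CausalOT.attainment_and_duality (ν := ν) hc hc_bdd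
    (CausalOT.containsTests_classS hμ) fun F hF γ hγ => CausalOT.classS_annihilated hF hγ).2⟩
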